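/- Let $k$ be a field of prime characteristic $p$, $S=k[x_1,\dots,x_m]$, and let $f=[2]+[1]$, where $[2]=c_2x^{u}$ and $[1]=c_1x^{v}$ with $c_1,c_2\in k\setminus\{0\}$ and $u,v\in\mathbb N^m$. Put $\Delta_i=v_i-u_i$, and let the variables be numbered so that $\Delta_1\le\dots\le\Delta_m$. Let $r,s,t$ be the numbers of $i$ with $\Delta_i<0$, $\Delta_i=0$, $\Delta_i>0$, and suppose $r\ge 1$ (this holds whenever $[2]$ is the larger of two distinct terms in the degree lexicographic order). Write $N_i=x_{r+1-i}$ $(1\le i\le r)$, $Z_i=x_{r+s+1-i}$ $(1\le i\le s)$, $P_q=x_{r+s+q}$ $(1\le q\le t)$. For a variable $Y=x_i$ let $\Delta_Y=\Delta_i$, $Y_{\max}=\max(u_i,v_i)$, $Y_{\min}=\min(u_i,v_i)$; we write $N_{i,\max}$ for $(N_i)_{\max}$, and so on. Fix $n$, put $Q=p^n$ and define the following integers. **Negative difference variables.** For $1\le i\le r$ let $a_i=-\Delta_{N_i}$, $b_i=N_{i,\min}$, and $Q-1=a_iM_{a_i}+r_{a_i}$ with $0\le r_{a_i}<a_i$.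 If $b_i\ge a_i$, let $y_{a_i}$ be the least positive multiple of $a_i$ that is $\ge b_i-r_{a_i}$, and $q_{a_i}=y_{a_i}/a_i$. Let $p_{a_i}=0$ if $b_i<a_i$ and $r_{a_i}\ge b_i$; $p_{a_i}=1$ if $b_i<a_i$ and $r_{a_i}<b_i$; $p_{a_i}=q_{a_i}$ if $b_i\ge a_i$. Let $E_i=r_{a_i}-b_i$, $\;r_{a_i}-b_i+a_i$, $\;y_{a_i}-(b_i-r_{a_i})$ in these three cases respectively. Let $\tilde k_{i}$ be the smallest positive integer $\ge (Q-N_{i,\max}-1-E_i)/a_i$, and $$D_{a_i,a_r}=1+E_i+a_i(M_{a_i}-p_{a_i}-M_{a_r}+p_{a_r}),\quad a_i'=Q-N_{i,\max}-\bigl(1+E_i+a_i(\tilde k_i-1)\bigr),\quad \tilde X_i=M_{a_r}-p_{a_r}-M_{a_i}+p_{a_i}+\tilde k_i .$$ **The function $\Phi$.** For $M\in\mathbb Z$ and $1\le q\le t$ let $\mu_q=\min\{Q-P_{q,\min},\,M\Delta_{P_q}\}$, $d_q=\min\{P_{q,\max}-1,\,Q-\mu_q-1\}-P_{q,\min}+1$,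 $h_q=\max\{Q-\mu_q-P_{q,\max},0\}$ and $C_q=Q^{t-q+1}$. Put $A_{t+1}=0$, $C_{t+1}=1$, $D_{t+1}=1$, $\tilde D_{t+1}=0$, and, downwards in $q$, $$A_q=(Q-P_{q,\min})A_{q+1}+P_{q,\min}C_{q+1},\qquad D_q=\mu_qA_{q+1}+(Q-P_{q,\min}-\mu_q)D_{q+1}+P_{q,\min}C_{q+1},$$ $$\tilde D_q=\mu_qA_{q+1}+\epsilon_q\,(h_q\tilde D_{q+1}+d_qD_{q+1})+P_{q,\min}C_{q+1},$$ where $\epsilon_q=1$ if $\mu_q<Q-P_{q,\min}$ and $\epsilon_q=0$ otherwise. Let $\mathfrak S_{M,0}=\tilde D_1$ (so $\mathfrak S_{M,0}=0$ if $t=0$), $\mathfrak S_{M,j}=(Q-Z_{j,\min})\mathfrak S_{M,j-1}+Z_{j,\min}Q^{t+j-1}$ for $1\le j\le s$, and $\Phi_M=\mathfrak S_{M,s}$. **The numbers $G$.** Let $G_{P_t}=0$ and $G_{P_{q}}=(Q-P_{q+1,\max})G_{P_{q+1}}+P_{q+1,\max}Q^{t-q-1}$ for $0\le q<t$; let $G_{Z_1}=G_{P_0}$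 and $G_{Z_{l+1}}=(Q-Z_{l,\max})G_{Z_l}+Z_{l,\max}Q^{t+l-1}$ for $1\le l\le s$; let $G_{N_1}=G_{Z_{s+1}}$ and $G_{N_{i+1}}=(Q-N_{i,\min})G_{N_i}+N_{i,\min}Q^{t+s+i-1}$ for $1\le i<r$. **The integrals.** Let $\int_j^{(N_1)}=\Phi_{M_{a_r}-p_{a_r}-j}$. For $1\le i<r$ put $K_{i}=(N_{i,\max}-N_{i,\min})G_{N_{i}}+N_{i,\min}Q^{s+t+i-1}$ and let $$\int_j^{(N_{i+1})}=\begin{cases}(D_{a_i,a_r}+ja_i)\int_j^{(N_i)}+a_i\sum_{j<l<\tilde X_i}\int_l^{(N_i)}+a_i'\int_{\tilde X_i}^{(N_i)}+K_i,& j<\tilde X_i,\\ (Q-N_{i,\max})\int_j^{(N_i)}+K_i,& j\ge\tilde X_i.\end{cases}$$ Define $K_r$ by the same expression as $K_i$, with $i=r$. **(1) The formula.** Suppose that $u_i<Q$ and $v_i\le Q$ for all $i$, and that $M_{a_r}-p_{a_r}\le M_{a_i}-p_{a_i}$ for $1\le i\le r$. Then $S/((x_1^{Q},\dots,x_m^{Q})+(f))$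 has finite length, and $$l\bigl(S/((x_1^{p^n},\dots,x_m^{p^n})+(f))\bigr)=D_{a_r,a_r}\int_0^{(N_r)}+a_r\sum_{0<j<\tilde X_r}\int_j^{(N_r)}+a_r'\int_{\tilde X_r}^{(N_r)}+K_r .$$ **(2) The expanded form.** Suppose in addition that $1\le\tilde X_1\le\tilde X_2\le\dots\le\tilde X_r$. Let $F^{(1)}_j=1$, $F^{(2)}_j=2j-1$, $F_j^{(l)}=\sum_{i=1}^{j-1}F_i^{(l-1)}+jF_j^{(l-1)}$ for $l\ge3$, and $H_l^{(i)}=\sum_{T}\prod_{c\in T}a_c\prod_{c\in\{i,\dots,r\}\setminus T}D_{a_c,a_r}$ over all $T\subseteq\{i,\dots,r\}$ with $|T|=l$. Let $C_j^{(N_r)}$ be the coefficient of $\int_j^{(N_r)}$ in (1), that is $D_{a_r,a_r}$, $a_r$, $a_r'$ for $j=0$, $0<j<\tilde X_r$, $j=\tilde X_r$, respectively. For $1\le i<r$ let $C_0^{(N_i)}=\prod_{c=i}^rD_{a_c,a_r}$; let $C_j^{(N_i)}=\sum_{l=1}^{r-i+1}F_j^{(l)}H_l^{(i)}$ for $1\le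 j<\tilde X_i$; let $C_{\tilde X_i}^{(N_i)}=a_i'\sum_{j=0}^{\tilde X_i-1}C_j^{(N_{i+1})}+(Q-N_{i,\max})C_{\tilde X_i}^{(N_{i+1})}$; and let $C_j^{(N_i)}=(Q-N_{i,\max})C_j^{(N_{i+1})}$ for $\tilde X_i<j\le\tilde X_r$. If $r=1$, put $C^{(N_2)}_0=1$ and $C_j^{(N_2)}=0$ for $j>0$. Then the length in (1) also equals $$\sum_{j=0}^{\tilde X_1-1}C_j^{(N_1)}\int_j^{(N_1)}+\Bigl[a_1'\sum_{j=0}^{\tilde X_1-1}C_j^{(N_2)}+(Q-N_{1,\max})C^{(N_2)}_{\tilde X_1}\Bigr]\int_{\tilde X_1}^{(N_1)}+(Q-N_{1,\max})\sum_{j=\tilde X_1+1}^{\tilde X_r}C_j^{(N_2)}\int_j^{(N_1)}+K_r$$ $$+\sum_{c=1}^{r-1}K_{r-c}\Bigl[C_0^{(N_{r-c+1})}+\sum_{l=1}^{c}H_l^{(r-c+1)}\sum_{j=1}^{\tilde X_{r-c+1}-1}F_j^{(l)}+\sum_{j=\tilde X_{r-c+1}}^{\tilde X_r}C_j^{(N_{r-c+1})}\Bigr].$$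 **(3) Closed form of $\Phi$ in the simple case.** Let $n\ge 0$, $t\ge1$, $M\in\mathbb Z$, and suppose $Q-P_{q,\max}\le\mu_q<Q-P_{q,\min}$ for $1\le q\le t$. For $2\le l\le t$ let $E_l$ be the sum of all products over $l$ distinct indices $q$ of factors $\mu_q$ or $P_{q,\min}$ in which both kinds of factors occur. Then $$\Phi_M=\Bigl[\prod_{q=1}^t(Q-M\Delta_{P_q})+\sum_{l=2}^t(-1)^lE_lQ^{t-l}\Bigr]\prod_{i=1}^s(Q-Z_{i,\min})+\sum_{c=1}^s(-1)^{c+1}Q^{t+s-c}\sum_{i_1<\dots<i_c}Z_{i_1,\min}\cdots Z_{i_c,\min}.$$ **(4) Range of validity.** If $b_i\le b_r$ for all $i$ with $a_i=a_r$ (which can always be achieved by renumbering variables with equal $\Delta_i$), then the hypotheses of (1) and (2) hold for all sufficiently large $n$. -/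

import Mathlib

/-!
Notation for the Hilbert–Kunz function of a binomial hypersurface `f = [2] + [1]` in
`k[x_1, …, x_m]`.  In all definitions below `Q` stands for `p ^ n`, and the indices
`i`, `l`, `q` of the variables `N_i`, `Z_l`, `P_q` start at `1`.
-/

noncomputable section

namespace BinomialHK

/-- The exponent vectors of the two terms `[2]` and `[1]` of a binomial. -/
structure Exponents (m : ℕ) where
  /-- exponents of the term `[2]` -/
  e₂ : Fin m → ℕ
  /-- exponents of the term `[1]` -/
  e₁ : Fin m → ℕ

/-- The binomial `c₂ x^{e₂} + c₁ x^{e₁}`. -/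
def Exponents.poly {m : ℕ} (B : Exponents m) {k : Type*} [Field k] (c₂ c₁ : k) :
    MvPolynomial (Fin m) k :=
  MvPolynomial.monomial (Finsupp.equivFunOnFinite.symm B.e₂) c₂ +
    MvPolynomial.monomial (Finsupp.equivFunOnFinite.symm B.e₁) c₁

/-- The Frobenius power `(x_1^Q, …, x_m^Q)` of the ideal `(x_1, …, x_m)`. -/
def frobeniusPower (m : ℕ) (k : Type*) [Field k] (Q : ℕ) : Ideal (MvPolynomial (Fin m) k) :=
  Ideal.span (Set.range fun i : Fin m => (MvPolynomial.X i : MvPolynomial (Fin m) k) ^ Q)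

/-- The length of `S / ((x_1^Q, …, x_m^Q) + (f))`, where `S = k[x_1, …, x_m]`. -/
def hkLength {m : ℕ} {k : Type*} [Field k] (f : MvPolynomial (Fin m) k) (Q : ℕ) : ℕ∞ :=
  Module.length (MvPolynomial (Fin m) k)
    (MvPolynomial (Fin m) k ⧸ (frobeniusPower m k Q ⊔ Ideal.span {f}))

namespace Exponents

variable {m : ℕ} (B : Exponents m) (Q : ℕ)

/-! ### The variables -/

/-- `Δ_i`: the exponent of `x_i` in `[1]` minus its exponent in `[2]`. -/
def Δ (i : Fin m) : ℤ := (B.e₁ i : ℤ) - B.e₂ i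

/-- The number of negative difference variables. -/
def r : ℕ := (Finset.univ.filter fun i => B.Δ i < 0).card

/-- The number of zero difference variables. -/
def s : ℕ := (Finset.univ.filter fun i => B.Δ i = 0).card

/-- The number of positive difference variables. -/
def t : ℕ := m - (B.r + B.s)

/-- The larger exponent in `f` of the variable at position `j` (positions start at `0`). -/
def expMax (j : ℕ) : ℤ := if h : j < m then max (B.e₂ ⟨j, h⟩) (B.e₁ ⟨j, h⟩) else 0

/-- The smaller exponent in `f` of the variable at position `j` (positions start at `0`). -/
def expMin (j : ℕ) : ℤ := if h : j < m then min (B.e₂ ⟨j, h⟩) (B.e₁ ⟨j, h⟩) else 0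

/-- The difference of the variable at position `j` (positions start at `0`). -/
def diff (j : ℕ) : ℤ := if h : j < m then B.Δ ⟨j, h⟩ else 0

/-- `N_i` is the variable `x_{r+1-i}`, which stands at position `r - i`. -/
def NMax (i : ℕ) : ℤ := B.expMax (B.r - i)

def NMin (i : ℕ) : ℤ := B.expMin (B.r - i)

/-- `Z_i` is the variable `x_{r+s+1-i}`, which stands at position `r + s - i`. -/
def ZMax (i : ℕ) : ℤ := B.expMax (B.r + B.s - i)

def ZMin (i : ℕ) : ℤ := B.expMin (B.r + B.s - i)

/-- `P_q` is the variable `x_{r+s+q}`, which stands at position `r + s + q - 1`. -/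
def PMax (q : ℕ) : ℤ := B.expMax (B.r + B.s + q - 1)

def PMin (q : ℕ) : ℤ := B.expMin (B.r + B.s + q - 1)

def ΔP (q : ℕ) : ℤ := B.diff (B.r + B.s + q - 1)

/-- `a_i = -Δ_{N_i}` -/
def a (i : ℕ) : ℤ := -B.diff (B.r - i)

/-- `b_i = N_{i,min}` -/
def b (i : ℕ) : ℤ := B.NMin i

/-! ### The numbers attached to the negative difference variables -/

/-- `M_{a_i,n}`, the quotient of `p ^ n - 1` by `a_i` -/
def Mq (i : ℕ) : ℤ := ((Q : ℤ) - 1) / B.a i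

/-- `r_{a_i,n}`, the remainder of `p ^ n - 1` by `a_i` -/
def rem (i : ℕ) : ℤ := ((Q : ℤ) - 1) % B.a i

/-- `y_{a_i}`: the least positive integer `≥ b_i - r_{a_i,n}` that is divisible by `a_i`. -/
def y (i : ℕ) : ℤ :=
  ((sInf {z : ℕ | 0 < z ∧ B.b i - B.rem Q i ≤ z ∧ B.a i ∣ z} : ℕ) : ℤ)

/-- `q_{a_i}`, with `y_{a_i} = a_i q_{a_i}` -/
def qa (i : ℕ) : ℤ := B.y Q i / B.a i

/-- `p_{a_i}` -/
def pa (i : ℕ) : ℤ :=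
  if B.b i < B.a i then (if B.b i ≤ B.rem Q i then 0 else 1) else B.qa Q i

/-- `E_{a_i,b_i}` -/
def E (i : ℕ) : ℤ :=
  if B.pa Q i = 0 then B.rem Q i - B.b i
  else if B.pa Q i = 1 then (B.rem Q i - B.b i) + B.a i
  else B.y Q i - (B.b i - B.rem Q i)

/-- The smallest positive integer `≥ β`. -/
def leastPos (β : ℚ) : ℤ := max 1 ⌈β⌉

/-- `k̃_{N_i,last}` -/
def kLast (i : ℕ) : ℤ :=
  leastPos ((((Q : ℤ) - B.NMax i - 1 - B.E Q i : ℤ) : ℚ) / (B.a i : ℚ))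

/-- `D_{a_i,a_r}` -/
def Da (i : ℕ) : ℤ :=
  (1 + B.E Q i) + B.a i * (B.Mq Q i - B.pa Q i - B.Mq Q B.r + B.pa Q B.r)

/-- `a_i'` -/
def a' (i : ℕ) : ℤ := Q - B.NMax i - (1 + B.E Q i + B.a i * (B.kLast Q i - 1))

/-- `X̃_{N_i,last}` -/
def Xlast (i : ℕ) : ℤ := B.Mq Q B.r - B.pa Q B.r - B.Mq Q i + B.pa Q i + B.kLast Q i

/-! ### The function `Φ` -/

/-- `Min^c_{P_q,M}` -/
def minc (M : ℤ) (q : ℕ) : ℤ := min (Q - B.PMin q) (M * B.ΔP q)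

/-- `s_{P_q,M}` -/
def sP (M : ℤ) (q : ℕ) : ℤ := min (B.PMax q - 1) (Q - B.minc Q M q - 1)

/-- `d_{P_q,M}` -/
def dP (M : ℤ) (q : ℕ) : ℤ := B.sP Q M q - B.PMin q + 1

/-- `h_{P_q,M}` -/
def hP (M : ℤ) (q : ℕ) : ℤ :=
  if B.PMax q < Q - B.minc Q M q then (Q - B.minc Q M q) - B.PMax q else 0

/-- `C_q = p^{(t-q+1)n}` -/
def Cq (q : ℕ) : ℤ := (Q : ℤ) ^ (B.t + 1 - q)

/-- `A_q`, with `A_{t+1} = 0` -/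
def Aq (q : ℕ) : ℤ :=
  if B.t < q then 0
  else (Q - B.PMin q) * Aq (q + 1) + B.PMin q * B.Cq Q (q + 1)
termination_by B.t + 1 - q

/-- `D_{q,M}`, with `D_{t+1,M} = 1` -/
def Dq (M : ℤ) (q : ℕ) : ℤ :=
  if B.t < q then 1
  else B.minc Q M q * B.Aq Q (q + 1) + (Q - B.PMin q - B.minc Q M q) * Dq M (q + 1)
    + B.PMin q * B.Cq Q (q + 1)
termination_by B.t + 1 - q

/-- `D̃_{q,M}`, with `D̃_{t+1,M} = 0` -/
def Dtilde (M : ℤ) (q : ℕ) : ℤ :=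
  if B.t < q then 0
  else if B.minc Q M q < Q - B.PMin q then
    B.minc Q M q * B.Aq Q (q + 1) + B.hP Q M q * Dtilde M (q + 1)
      + B.dP Q M q * B.Dq Q M (q + 1) + B.PMin q * B.Cq Q (q + 1)
  else B.minc Q M q * B.Aq Q (q + 1) + B.PMin q * B.Cq Q (q + 1)
termination_by B.t + 1 - q

/-- `B_{P_1,M}` -/
def BP (M : ℤ) : ℤ :=
  if B.minc Q M 1 < Q - B.PMin 1 then
    B.hP Q M 1 * B.Dtilde Q M 2 + B.dP Q M 1 * B.Dq Q M 2
  else 0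

/-- `𝔖_{M,j}`; if there are no positive difference variables, then `𝔖_{M,0} = 0`. -/
def frakS (M : ℤ) : ℕ → ℤ
  | 0 => if B.t = 0 then 0
      else B.Aq Q 2 * B.minc Q M 1 + B.BP Q M + B.Cq Q 2 * B.PMin 1
  | j + 1 => frakS M j * (Q - B.ZMin (j + 1)) + (Q : ℤ) ^ (B.t + j) * B.ZMin (j + 1)

/-- `Φ_M = 𝔖_{M,s}` -/
def Φ (M : ℤ) : ℤ := B.frakS Q M B.s

/-! ### The numbers `G` -/

/-- `G_{P_q}`.  The value `G_{P_t} = 0` gives `G_{P_{t-1}} = P_{t,max}`. -/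
def GP (q : ℕ) : ℤ :=
  if B.t ≤ q then 0
  else (Q - B.PMax (q + 1)) * GP (q + 1) + B.PMax (q + 1) * (Q : ℤ) ^ (B.t - q - 1)
termination_by B.t - q

/-- `G_{Z_l}` for `l ≥ 1`.  The value at `l = 1` is
`(p^n - P_{1,max}) G_{P_1} + P_{1,max} p^{n(t-1)}` (and `0` if `t = 0`), and the value at
`l = s + 1` is the number `G_{N_1}`. -/
def GZ : ℕ → ℤ
  | 0 => 0
  | 1 => B.GP Q 0
  | l + 2 => (Q - B.ZMax (l + 1)) * GZ (l + 1) + B.ZMax (l + 1) * (Q : ℤ) ^ (B.t + l)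

/-- `G_{N_i}` for `i ≥ 1` -/
def GN : ℕ → ℤ
  | 0 => 0
  | 1 => B.GZ Q (B.s + 1)
  | i + 2 => (Q - B.NMin (i + 1)) * GN (i + 1) + B.NMin (i + 1) * (Q : ℤ) ^ (B.t + B.s + i)

/-! ### The iterative formula -/

/-- `∫_j^{(N_i)}` for `i ≥ 1` -/
def integral : ℕ → ℤ → ℤ
  | 0, _ => 0
  | 1, j => B.Φ Q (B.Mq Q B.r - B.pa Q B.r - j)
  | i + 2, j =>
    if j < B.Xlast Q (i + 1) then
      (B.Da Q (i + 1) + j * B.a (i + 1)) * integral (i + 1) j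
        + ∑ l ∈ Finset.Ioo j (B.Xlast Q (i + 1)), B.a (i + 1) * integral (i + 1) l
        + B.a' Q (i + 1) * integral (i + 1) (B.Xlast Q (i + 1))
        + (B.NMax (i + 1) - B.NMin (i + 1)) * B.GN Q (i + 1)
        + B.NMin (i + 1) * (Q : ℤ) ^ (B.s + B.t + i)
    else
      (Q - B.NMax (i + 1)) * integral (i + 1) j
        + (B.NMax (i + 1) - B.NMin (i + 1)) * B.GN Q (i + 1)
        + B.NMin (i + 1) * (Q : ℤ) ^ (B.s + B.t + i)

/-- The iterative formula for the Hilbert–Kunz function. -/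
def hkFormula : ℤ :=
  B.Da Q B.r * B.integral Q B.r 0
    + ∑ j ∈ Finset.Ioo 0 (B.Xlast Q B.r), B.a B.r * B.integral Q B.r j
    + B.a' Q B.r * B.integral Q B.r (B.Xlast Q B.r)
    + (B.NMax B.r - B.NMin B.r) * B.GN Q B.r
    + B.NMin B.r * (Q : ℤ) ^ (B.s + B.t + B.r - 1)

/-! ### The expanded formula -/

/-- `F_j^{(l)}` for `l ≥ 1` -/
def F : ℕ → ℤ → ℤ
  | 0, _ => 0
  | 1, _ => 1
  | 2, j => 2 * j - 1
  | l + 3, j => (∑ i ∈ Finset.Icc 1 (j - 1), F (l + 2) i) + j * F (l + 2) j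

/-- `H_l^{(i)}`: the sum of the products that contain, for every index `k` in `{i, …, r}`,
one of the factors `a_k` and `D_{a_k,a_r}`, the first one for exactly `l` indices. -/
def H (l i : ℕ) : ℤ :=
  ∑ T ∈ (Finset.Icc i B.r).powersetCard l,
    (∏ k ∈ T, B.a k) * ∏ k ∈ Finset.Icc i B.r \ T, B.Da Q k

/-- `C_j^{(N_i)}`.  For `i = r` these are the coefficients of `∫_j^{(N_r)}` in `hkFormula`;
for `i = r + 1` the values are those of an empty product, which makes sense of `C_j^{(N_2)}`
if `r = 1`. -/
def C (i : ℕ) (j : ℤ) : ℤ :=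
  if B.r < i then (if j = 0 then 1 else 0)
  else if i = B.r then
    (if j = 0 then B.Da Q B.r
      else if j < B.Xlast Q B.r then B.a B.r
      else if j = B.Xlast Q B.r then B.a' Q B.r
      else 0)
  else if j = 0 then ∏ k ∈ Finset.Icc i B.r, B.Da Q k
  else if j < B.Xlast Q i then ∑ l ∈ Finset.Icc 1 (B.r - i + 1), F l j * B.H Q l i
  else if j = B.Xlast Q i then
    B.a' Q i * (∑ j' ∈ Finset.Ico 0 (B.Xlast Q i), C (i + 1) j')
      + (Q - B.NMax i) * C (i + 1) (B.Xlast Q i)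
  else (Q - B.NMax i) * C (i + 1) j
termination_by B.r + 1 - i

/-- The expanded form of the formula for the Hilbert–Kunz function. -/
def hkExpanded : ℤ :=
  (∑ j ∈ Finset.Ico 0 (B.Xlast Q 1), B.C Q 1 j * B.integral Q 1 j)
    + (B.a' Q 1 * (∑ j ∈ Finset.Ico 0 (B.Xlast Q 1), B.C Q 2 j)
        + (Q - B.NMax 1) * B.C Q 2 (B.Xlast Q 1)) * B.integral Q 1 (B.Xlast Q 1)
    + (Q - B.NMax 1) *
        (∑ j ∈ Finset.Icc (B.Xlast Q 1 + 1) (B.Xlast Q B.r), B.C Q 2 j * B.integral Q 1 j)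
    + (B.NMax B.r - B.NMin B.r) * B.GN Q B.r
    + B.NMin B.r * (Q : ℤ) ^ (B.s + B.t + B.r - 1)
    + ∑ c ∈ Finset.Icc 1 (B.r - 1),
        ((B.NMax (B.r - c) - B.NMin (B.r - c)) * B.GN Q (B.r - c)
            + B.NMin (B.r - c) * (Q : ℤ) ^ (B.s + B.t + B.r - c - 1)) *
          (B.C Q (B.r - c + 1) 0
            + (∑ l ∈ Finset.Icc 1 c, B.H Q l (B.r - c + 1) *
                ∑ j ∈ Finset.Icc 1 (B.Xlast Q (B.r - c + 1) - 1), F l j)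
            + ∑ j ∈ Finset.Icc (B.Xlast Q (B.r - c + 1)) (B.Xlast Q B.r),
                B.C Q (B.r - c + 1) j)

/-! ### The closed form of `Φ` in the simple case -/

/-- `E_l`: the sum of the products over `l` distinct indices of factors `Min^c_{P_q,M}` or
`P_{q,min}`, where both kinds of factors occur. -/
def mixedSum (M : ℤ) (l : ℕ) : ℤ :=
  ∑ T ∈ (Finset.Icc 1 B.t).powersetCard l,
    ∑ U ∈ T.powerset.filter (fun U => U ≠ ∅ ∧ U ≠ T),
      (∏ q ∈ U, B.minc Q M q) * ∏ q ∈ T \ U, B.PMin q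

/-- The closed form of `Φ_M`. -/
def ΦClosed (M : ℤ) : ℤ :=
  ((∏ q ∈ Finset.Icc 1 B.t, ((Q : ℤ) - M * B.ΔP q))
      + ∑ l ∈ Finset.Icc 2 B.t, (-1) ^ l * B.mixedSum Q M l * (Q : ℤ) ^ (B.t - l)) *
    (∏ i ∈ Finset.Icc 1 B.s, ((Q : ℤ) - B.ZMin i))
  + ∑ c ∈ Finset.Icc 1 B.s, (-1) ^ (c + 1) * (Q : ℤ) ^ (B.t + B.s - c) *
      ∑ T ∈ (Finset.Icc 1 B.s).powersetCard c, ∏ i ∈ T, B.ZMin i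

/-- The simple case: `p^n - P_{q,max} ≤ Min^c_{P_q,M} < p^n - P_{q,min}` for all `q`. -/
def Simple (M : ℤ) : Prop :=
  ∀ q, 1 ≤ q → q ≤ B.t →
    (Q : ℤ) - B.PMax q ≤ B.minc Q M q ∧ B.minc Q M q < Q - B.PMin q

/-! ### The range of `p ^ n` in which the formulas are meant -/

/-- The term `[2]` divides some monomial with all exponents `< Q`, no exponent of `[1]` exceeds
`Q`, and `M_{a_r,n} - p_{a_r}` is the least of the numbers `M_{a_i,n} - p_{a_i}`. -/
def Admissible : Prop :=
  (∀ i, B.e₂ i < Q) ∧ (∀ i, B.e₁ i ≤ Q) ∧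
    ∀ i, 1 ≤ i → i ≤ B.r → B.Mq Q B.r - B.pa Q B.r ≤ B.Mq Q i - B.pa Q i

/-- `1 ≤ X̃_{N_1,last} ≤ X̃_{N_2,last} ≤ … ≤ X̃_{N_r,last}` -/
def XOrdered : Prop :=
  1 ≤ B.Xlast Q 1 ∧ ∀ i, 1 ≤ i → i < B.r → B.Xlast Q i ≤ B.Xlast Q (i + 1)

end Exponents

end BinomialHK

end

/-! Modulo the binomial, x^(γ+v) = ρ x^(γ+u) with the unit ρ = -c₂/c₁. So the monomials fall into
chains whose steps add v - u and start at points ≥ u. Some variable strictly decreases along each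
step, so chains have no cycles. A monomial from which the chain runs into an exponent ≥ Q is zero in
the quotient. A chain that stays in the box [0, Q)^m contributes one dimension, spanned by its first
monomial, the one not divisible by x^v. Hence the length is the number of such chain starts
(`length_quotient_binomialIdeal`).

The starts are counted one variable at a time, looking only at the first c steps (`startCount`). A
variable with negative difference -a and exponent v + y allows exactly ⌊y/a⌋ steps, so it only
lowers the cap c for the remaining variables (`startCount_neg_diff`). A zero difference variable
gives a constant factor, and the positive difference variables are handled together by inclusion and
exclusion (`startCount_pos_diff`).

The stated integers are these counts in disguise. By `div_spec`, K_i = M_{a_i} - p_{a_i} is the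
quotient of Q - 1 - b_i by a_i, that is, the largest number of steps N_i allows. The numbers G are
the counts with cap 0, and ∫_j is the count with cap K_r - j (`integral_eq_startCount`). Minimality
of K_r ensures that these caps fit every negative variable. The whole count has cap K_r, hence j =
0.

The expanded form is the same recursion transposed: the coefficients of the integrals are updated
instead of the integrals, and products of F and H solve the transposed recursion (`C_step`,
`sum_mul_step`). The closed form of Φ comes from writing its recursion as differences of products
(`Dtilde_eq`), one of which vanishes in the simple case. For large Q a smaller a_i forces a larger
quotient K_i, which gives the range of validity (`quotient_le_quotient`). -/

namespace BinomialHK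

open MvPolynomial

/-! ### Length over the polynomial ring and dimension over the field -/

section Length

variable {k σ : Type*} [Field k]

/-- A simple module over a polynomial ring on which all variables act nilpotently is simple over
the ground field. -/
theorem isSimpleModule_of_nilpotent {M : Type*} [AddCommGroup M] [Module (MvPolynomial σ k) M]
    [Module k M] [IsScalarTower k (MvPolynomial σ k) M] [IsSimpleModule (MvPolynomial σ k) M]
    (h : ∀ i : σ, ∃ d : ℕ, ∀ x : M, (X i : MvPolynomial σ k) ^ d • x = 0) :
    IsSimpleModule k M := by
  have hX : ∀ (i : σ) (x : M), (X i : MvPolynomial σ k) • x = 0 := by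
    intro i
    obtain ⟨d, hd⟩ := h i
    -- Schur's lemma: multiplication by a variable is injective or zero, and nilpotence excludes the
    -- former. The ring then acts through constant coefficients.
    rcases LinearMap.injective_or_eq_zero
      (LinearMap.lsmul (MvPolynomial σ k) M (X i)) with hi | h0
    · exfalso
      obtain ⟨x, hx⟩ := @exists_ne M (IsSimpleModule.nontrivial (MvPolynomial σ k) M) 0
      have hinj : ∀ e : ℕ, (X i : MvPolynomial σ k) ^ e • x ≠ 0 := by
        intro e
        induction e with
        | zero => simpa using hx
        | succ e ih =>
          intro h0
          rw [pow_succ', mul_smul] at h0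
          exact ih (hi (by rw [map_zero]; exact h0))
      exact hinj d (hd x)
    · intro x
      simpa using LinearMap.congr_fun h0 x
  have hsmul : ∀ (f : MvPolynomial σ k) (x : M), f • x = (constantCoeff f) • x := by
    intro f x
    induction f using MvPolynomial.induction_on with
    | C a => rw [constantCoeff_C, ← algebraMap_eq, algebraMap_smul]
    | add f g hf hg => rw [add_smul, hf, hg, map_add, add_smul]
    | mul_X f i _ => rw [mul_smul, hX]; simp
  have : Nontrivial M := IsSimpleModule.nontrivial (MvPolynomial σ k) M
  rw [isSimpleModule_iff_toSpanSingleton_surjective]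
  refine ⟨this, fun x hx y => ?_⟩
  obtain ⟨f, hf⟩ := IsSimpleModule.toSpanSingleton_surjective (MvPolynomial σ k) hx y
  exact ⟨constantCoeff f, by simpa [hsmul] using hf⟩

/-- If all variables act nilpotently, the length over the polynomial ring is the length over the
ground field. -/
theorem length_eq_of_nilpotent {M : Type*} [AddCommGroup M] [Module (MvPolynomial σ k) M]
    (hM : IsFiniteLength (MvPolynomial σ k) M)
    [hk : Module k M] [ht : IsScalarTower k (MvPolynomial σ k) M]
    (h : ∀ i : σ, ∃ d : ℕ, ∀ x : M, (X i : MvPolynomial σ k) ^ d • x = 0) :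
    Module.length (MvPolynomial σ k) M = Module.length k M := by
  induction hM generalizing hk ht with
  | of_subsingleton => rw [Module.length_eq_zero, Module.length_eq_zero]
  | @of_simple_quotient M _ _ N hs hN ih =>
    have h₁ := ih (fun i => (h i).imp fun d hd x => Subtype.ext (hd x))
    have h₂ : IsSimpleModule k (M ⧸ N) := isSimpleModule_of_nilpotent fun i =>
      (h i).imp fun d hd x => by
        induction x using Submodule.Quotient.induction_on with
        | H x => rw [← Submodule.Quotient.mk_smul, hd, Submodule.Quotient.mk_zero]
    rw [Module.length_eq_add_of_exact N.subtype N.mkQ N.injective_subtype N.mkQ_surjective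
      (LinearMap.exact_subtype_mkQ N),
      Module.length_eq_add_of_exact (N.subtype.restrictScalars k) (N.mkQ.restrictScalars k)
        N.injective_subtype N.mkQ_surjective (LinearMap.exact_subtype_mkQ N), h₁,
      Module.length_eq_one _ (M ⧸ N), Module.length_eq_one k (M ⧸ N)]

end Length

end BinomialHK

namespace BinomialHK

open MvPolynomial

/-! ### Chains of monomials and a basis of the quotient -/

section Chains

variable {k : Type*} [Field k] {m : ℕ}

/-- The point `α` is reached from `β` by `j` steps `+ (v - u)` which all start at a point `≥ u`. -/
def Reaches (u v β : Fin m →₀ ℕ) (j : ℕ) (α : Fin m →₀ ℕ) : Prop :=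
  (∀ l < j, ∀ i, (u i : ℤ) ≤ β i + l * ((v i : ℤ) - u i)) ∧
    ∀ i, (α i : ℤ) = β i + j * ((v i : ℤ) - u i)

/-- The monomial `x^β` is the first one of a chain of monomials with exponents `< Q`. -/
def IsChainStart (u v : Fin m →₀ ℕ) (Q : ℕ) (β : Fin m →₀ ℕ) : Prop :=
  (∃ i, β i < v i) ∧ ∀ j : ℕ, (∀ l < j, ∀ i, (u i : ℤ) ≤ β i + l * ((v i : ℤ) - u i)) →
    ∀ i, (β i : ℤ) + j * ((v i : ℤ) - u i) < Q

/-- A variable with v_i < u_i strictly decreases along the chain, so its exponent determines the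
number of steps. -/
theorem Reaches.unique {u v β α : Fin m →₀ ℕ} {j j' : ℕ} {i : Fin m} (hi : v i < u i)
    (h : Reaches u v β j α) (h' : Reaches u v β j' α) : j = j' := by
  have h₁ := h.2 i
  have h₂ := h'.2 i
  have h₃ : ((j : ℤ) - j') * ((v i : ℤ) - u i) = 0 := by linarith
  rcases mul_eq_zero.1 h₃ with h₄ | h₄ <;> omega

theorem Reaches.exists_pred {u v β γ : Fin m →₀ ℕ} {j : ℕ} (hβ : ∃ i, β i < v i)
    (h : Reaches u v β j (γ + v)) : ∃ j', j = j' + 1 ∧ Reaches u v β j' (γ + u) := by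
  cases j with
  | zero =>
    obtain ⟨i, hi⟩ := hβ
    have := h.2 i
    simp at this
    omega
  | succ j =>
    refine ⟨j, rfl, fun l hl => h.1 l (by omega), fun i => ?_⟩
    have := h.2 i
    simp only [Finsupp.coe_add, Pi.add_apply] at this ⊢
    push_cast at this ⊢
    linarith

theorem Reaches.succ {u v β γ : Fin m →₀ ℕ} {j : ℕ}
    (h : Reaches u v β j (γ + u)) : Reaches u v β (j + 1) (γ + v) := by
  have h₂ : ∀ i, (γ i : ℤ) + u i = β i + j * ((v i : ℤ) - u i) := by
    intro i
    simpa using h.2 i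
  refine ⟨fun l hl i => ?_, fun i => ?_⟩
  · rcases Nat.lt_succ_iff_lt_or_eq.1 hl with hl | rfl
    · exact h.1 l hl i
    · have := h₂ i
      omega
  · have := h₂ i
    simp only [Finsupp.coe_add, Pi.add_apply]
    push_cast
    linarith

open Classical in
/-- The coefficient with which `x^α` is a multiple of `x^β` modulo the binomial
`c₂ x^u + c₁ x^v`, if `α` lies on the chain that starts at `β`; here `ρ = -c₂ / c₁`. -/
noncomputable def chainCoeff (u v : Fin m →₀ ℕ) (ρ : k) (β α : Fin m →₀ ℕ) : k :=
  if h : ∃ j, Reaches u v β j α then ρ ^ h.choose else 0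

theorem chainCoeff_of_reaches {u v β α : Fin m →₀ ℕ} {j : ℕ} {i : Fin m} (hi : v i < u i)
    (ρ : k) (h : Reaches u v β j α) : chainCoeff u v ρ β α = ρ ^ j := by
  have hex : ∃ j, Reaches u v β j α := ⟨j, h⟩
  rw [chainCoeff, dif_pos hex, hex.choose_spec.unique hi h]

theorem chainCoeff_of_not_reaches {u v β α : Fin m →₀ ℕ} (ρ : k)
    (h : ∀ j, ¬ Reaches u v β j α) : chainCoeff u v ρ β α = 0 :=
  dif_neg fun ⟨j, hj⟩ => h j hj

/-- This is the relation x^(γ+v) = ρ x^(γ+u) in coordinates. It needs β to have no predecessor: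
otherwise γ + v = β would have coefficient 1 without γ + u lying on the chain from β. -/
theorem chainCoeff_add {u v β : Fin m →₀ ℕ} {i : Fin m} (hi : v i < u i)
    (ρ : k) (hβ : ∃ i, β i < v i) (γ : Fin m →₀ ℕ) :
    chainCoeff u v ρ β (γ + v) = ρ * chainCoeff u v ρ β (γ + u) := by
  by_cases h : ∃ j, Reaches u v β j (γ + u)
  · obtain ⟨j, hj⟩ := h
    rw [chainCoeff_of_reaches hi ρ hj, chainCoeff_of_reaches hi ρ hj.succ, pow_succ']
  · rw [not_exists] at h
    rw [chainCoeff_of_not_reaches ρ h, chainCoeff_of_not_reaches ρ, mul_zero]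
    intro j hj
    obtain ⟨j', -, h'⟩ := hj.exists_pred hβ
    exact h j' h'

theorem chainCoeff_eq_zero_of_le {u v β α : Fin m →₀ ℕ} {Q : ℕ} (ρ : k)
    (hβ : IsChainStart u v Q β) {i : Fin m} (hα : Q ≤ α i) : chainCoeff u v ρ β α = 0 := by
  refine chainCoeff_of_not_reaches ρ fun j hj => ?_
  have h₁ := hβ.2 j hj.1 i
  have h₂ := hj.2 i
  omega

/-- After at least one step a point is ≥ v, so no start lies on the chain of another one. -/
theorem chainCoeff_start {u v β β' : Fin m →₀ ℕ} {i : Fin m} (hi : v i < u i) (ρ : k)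
    (hβ' : ∃ i, β' i < v i) : chainCoeff u v ρ β β' = if β' = β then 1 else 0 := by
  split_ifs with h
  · subst h
    rw [chainCoeff_of_reaches hi (j := 0) ρ ⟨by simp, by simp⟩, pow_zero]
  · refine chainCoeff_of_not_reaches ρ fun j hj => ?_
    cases j with
    | zero => exact h (by ext i; simpa using hj.2 i)
    | succ j =>
      obtain ⟨i, hi⟩ := hβ'
      have h₁ := hj.1 j (by omega) i
      have h₂ := hj.2 i
      push_cast at h₂
      have h₃ : (β' i : ℤ) = β i + j * ((v i : ℤ) - u i) + (v i - u i) := by linarith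
      omega

variable (u v : Fin m →₀ ℕ) (Q : ℕ) (c₂ c₁ : k)

/-- The ideal `(x_1^Q, …, x_m^Q) + (c₂ x^u + c₁ x^v)`. -/
noncomputable abbrev binomialIdeal : Ideal (MvPolynomial (Fin m) k) :=
  frobeniusPower m k Q ⊔ Ideal.span {monomial u c₂ + monomial v c₁}

/-- The linear map that sends a polynomial to its coordinates with respect to the first monomials
of the chains. -/
noncomputable def chainCoords (ρ : k) :
    MvPolynomial (Fin m) k →ₗ[k] ({β // IsChainStart u v Q β} → k) :=
  (basisMonomials (Fin m) k).constr k fun α β => chainCoeff u v ρ β.1 α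

theorem chainCoords_monomial (ρ c : k) (α : Fin m →₀ ℕ) (β : {β // IsChainStart u v Q β}) :
    chainCoords u v Q ρ (monomial α c) β = c * chainCoeff u v ρ β.1 α := by
  have h : monomial α c = c • basisMonomials (Fin m) k α := by
    rw [coe_basisMonomials, smul_monomial, smul_eq_mul, mul_one]
  rw [h, map_smul, chainCoords, Module.Basis.constr_basis]
  rfl

variable {u v Q c₂ c₁}

theorem monomial_mem_of_le {α : Fin m →₀ ℕ} {i : Fin m} (hα : Q ≤ α i) (c : k) :
    monomial α c ∈ binomialIdeal u v Q c₂ c₁ := by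
  refine Ideal.mem_sup_left ?_
  have h : monomial α c = monomial (α - Finsupp.single i Q) c * X i ^ Q := by
    rw [← monomial_add_single, tsub_add_cancel_of_le]
    simpa using hα
  rw [h]
  exact Ideal.mul_mem_left _ _ (Ideal.subset_span ⟨i, rfl⟩)

theorem chainCoords_eq_zero {i : Fin m} (hi : v i < u i) (hc₁ : c₁ ≠ 0)
    {f : MvPolynomial (Fin m) k} (hf : f ∈ binomialIdeal u v Q c₂ c₁) :
    chainCoords u v Q (-c₂ / c₁) f = 0 := by
  suffices h : ∀ g, chainCoords u v Q (-c₂ / c₁) (g * f) = 0 by simpa using h 1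
  rw [binomialIdeal, frobeniusPower, ← Ideal.span_union] at hf
  induction hf using Submodule.span_induction with
  | zero => simp
  | add f f' _ _ h h' => intro g; rw [mul_add, map_add, h, h', add_zero]
  | smul a f _ h => intro g; rw [smul_eq_mul, ← mul_assoc]; exact h _
  | mem f hf =>
    intro g
    induction g using MvPolynomial.induction_on' with
    | add g g' h h' => rw [add_mul, map_add, h, h', add_zero]
    | monomial γ c =>
      rcases hf with ⟨l, rfl⟩ | rfl
      · ext β
        simp only
        rw [← monomial_add_single, chainCoords_monomial,
          chainCoeff_eq_zero_of_le _ β.2 (i := l) (by simp), mul_zero]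
        rfl
      · ext β
        rw [mul_add, monomial_mul, monomial_mul, map_add, Pi.add_apply, chainCoords_monomial,
          chainCoords_monomial, chainCoeff_add hi _ β.2.1]
        simp only [Pi.zero_apply]
        field_simp
        ring

/-- `W` is only a subspace containing the ideal, so that the lemma serves both for the ideal and for
its sum with the span of the starts. -/
theorem monomial_mem_iff {W : Submodule k (MvPolynomial (Fin m) k)} (hc₁ : c₁ ≠ 0) (hc₂ : c₂ ≠ 0)
    (hW : (binomialIdeal u v Q c₂ c₁).restrictScalars k ≤ W) (γ : Fin m →₀ ℕ) :
    monomial (γ + v) (1 : k) ∈ W ↔ monomial (γ + u) (1 : k) ∈ W := by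
  have h : c₂ • monomial (γ + u) (1 : k) + c₁ • monomial (γ + v) (1 : k) ∈ W := by
    apply hW
    rw [Submodule.restrictScalars_mem]
    have : c₂ • monomial (γ + u) (1 : k) + c₁ • monomial (γ + v) (1 : k)
        = monomial γ 1 * (monomial u c₂ + monomial v c₁) := by
      simp [mul_add, monomial_mul, smul_monomial]
    rw [this]
    exact Ideal.mul_mem_left _ _ (Ideal.mem_sup_right (Ideal.mem_span_singleton_self _))
  rw [← W.smul_mem_iff hc₁, ← W.smul_mem_iff hc₂ (x := monomial (γ + u) (1 : k))]
  constructor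
  · intro h'; exact (W.add_mem_iff_left h').1 h
  · intro h'; exact (W.add_mem_iff_right h').1 h

/-- Membership in the ideal is carried backwards along the chain from the point where it leaves the
box. -/
theorem monomial_mem_of_leaves_box (hc₁ : c₁ ≠ 0) (hc₂ : c₂ ≠ 0) (j : ℕ) (α : Fin m →₀ ℕ)
    (h : ∀ l < j, ∀ i, (u i : ℤ) ≤ α i + l * ((v i : ℤ) - u i))
    (hout : ∃ i, (Q : ℤ) ≤ α i + j * ((v i : ℤ) - u i)) :
    monomial α (1 : k) ∈ binomialIdeal u v Q c₂ c₁ := by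
  induction j generalizing α with
  | zero =>
    obtain ⟨i, hi⟩ := hout
    exact monomial_mem_of_le (i := i) (by simpa using hi) 1
  | succ j ih =>
    have hle : u ≤ α := fun i => by simpa using h 0 (by omega) i
    obtain ⟨γ, rfl⟩ := exists_add_of_le hle
    have hmem := ih (γ + v) (fun l hl i => by
      have := h (l + 1) (by omega) i
      simp only [Finsupp.coe_add, Pi.add_apply] at this ⊢
      push_cast at this ⊢
      linarith) (by
      obtain ⟨i, hi⟩ := hout
      refine ⟨i, ?_⟩
      simp only [Finsupp.coe_add, Pi.add_apply] at hi ⊢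
      push_cast at hi ⊢
      linarith)
    have := (monomial_mem_iff hc₁ hc₂ (le_refl _) γ).1 hmem
    rw [add_comm u γ]
    exact this

theorem mem_ideal_sup_span {i : Fin m} (hi : v i < u i) (hc₁ : c₁ ≠ 0) (hc₂ : c₂ ≠ 0)
    (f : MvPolynomial (Fin m) k) :
    f ∈ (binomialIdeal u v Q c₂ c₁).restrictScalars k ⊔
      Submodule.span k (Set.range fun β : {β // IsChainStart u v Q β} => monomial β.1 (1 : k)) := by
  set W := (binomialIdeal u v Q c₂ c₁).restrictScalars k ⊔
      Submodule.span k (Set.range fun β : {β // IsChainStart u v Q β} => monomial β.1 (1 : k))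
    with hW
  have hIW : (binomialIdeal u v Q c₂ c₁).restrictScalars k ≤ W := le_sup_left
  -- Going back one step, from γ + v to γ + u, raises the exponent of the variable i. The induction
  -- on its distance to Q therefore ends at a start or outside the box.
  have key : ∀ (d : ℕ) (α : Fin m →₀ ℕ), Q ≤ α i + d → monomial α (1 : k) ∈ W := by
    intro d
    induction d with
    | zero => intro α hα; exact hIW (monomial_mem_of_le hα 1)
    | succ d ih =>
      intro α hα
      by_cases hle : v ≤ α
      · obtain ⟨γ, rfl⟩ := exists_add_of_le hle
        rw [add_comm, monomial_mem_iff hc₁ hc₂ hIW]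
        refine ih _ ?_
        simp only [Finsupp.coe_add, Pi.add_apply] at hα ⊢
        omega
      · have hlt : ∃ l, α l < v l := by
          by_contra hcon
          push Not at hcon
          exact hle hcon
        by_cases hstart : IsChainStart u v Q α
        · exact Submodule.mem_sup_right (Submodule.subset_span ⟨⟨α, hstart⟩, rfl⟩)
        · rw [IsChainStart, not_and] at hstart
          have := hstart hlt
          push Not at this
          obtain ⟨j, hj, hout⟩ := this
          exact hIW (monomial_mem_of_leaves_box hc₁ hc₂ j α hj hout)
  induction f using MvPolynomial.induction_on' with
  | add f g hf hg => exact add_mem hf hg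
  | monomial α c =>
    have : monomial α c = c • monomial α (1 : k) := by simp [smul_monomial]
    rw [this]
    exact W.smul_mem _ (key Q α (by omega))

theorem IsChainStart.lt {β : Fin m →₀ ℕ} (h : IsChainStart u v Q β) (i : Fin m) : β i < Q := by
  simpa using h.2 0 (by simp) i

instance : Finite {β // IsChainStart u v Q β} := by
  refine Finite.of_injective
    (fun β i => (⟨β.1 i, β.2.lt i⟩ : Fin Q) : {β // IsChainStart u v Q β} → (Fin m → Fin Q)) ?_
  intro β β' h
  refine Subtype.ext (Finsupp.ext fun i => ?_)
  exact Fin.mk.inj_iff.1 (congrFun h i)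

open Classical in
theorem chainCoords_start {i : Fin m} (hi : v i < u i) (ρ c : k)
    (β : {β // IsChainStart u v Q β}) :
    chainCoords u v Q ρ (monomial β.1 c) = Pi.single β c := by
  ext β'
  rw [chainCoords_monomial, chainCoeff_start hi _ β.2.1]
  by_cases h : β' = β
  · subst h; simp
  · rw [if_neg fun h' => h (Subtype.ext h'.symm), Pi.single_eq_of_ne h, mul_zero]

/-- Modulo the ideal, a polynomial is a combination of starts, and the coordinate vectors of the
starts are the standard basis. -/
theorem mem_of_chainCoords_eq_zero {i : Fin m} (hi : v i < u i) (hc₁ : c₁ ≠ 0) (hc₂ : c₂ ≠ 0)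
    {f : MvPolynomial (Fin m) k} (hf : chainCoords u v Q (-c₂ / c₁) f = 0) :
    f ∈ binomialIdeal u v Q c₂ c₁ := by
  classical
  have := Fintype.ofFinite {β // IsChainStart u v Q β}
  obtain ⟨g, hg, s, hs, rfl⟩ := Submodule.mem_sup.1 (mem_ideal_sup_span (Q := Q) hi hc₁ hc₂ f)
  rw [map_add, chainCoords_eq_zero hi hc₁ hg, zero_add] at hf
  obtain ⟨c, rfl⟩ := (Submodule.mem_span_range_iff_exists_fun k).1 hs
  have hc : c = 0 := by
    simpa [smul_monomial, chainCoords_start hi, Finset.univ_sum_single, -map_smul] using hf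
  rw [hc]
  simp only [Pi.zero_apply, zero_smul, Finset.sum_const_zero, add_zero]
  exact hg

theorem chainCoords_surjective {i : Fin m} (hi : v i < u i) (ρ : k) :
    Function.Surjective (chainCoords u v Q ρ) := by
  classical
  have := Fintype.ofFinite {β // IsChainStart u v Q β}
  intro c
  refine ⟨∑ β : {β // IsChainStart u v Q β}, monomial β.1 (c β), ?_⟩
  simp_rw [map_sum, chainCoords_start hi]
  exact Finset.univ_sum_single c

/-- The length of `S / ((x_1^Q, …, x_m^Q) + (c₂ x^u + c₁ x^v))` is the number of chains of
monomials with exponents `< Q`. -/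
theorem length_quotient_binomialIdeal {i : Fin m} (hi : v i < u i) (hc₁ : c₁ ≠ 0) (hc₂ : c₂ ≠ 0) :
    Module.length (MvPolynomial (Fin m) k)
      (MvPolynomial (Fin m) k ⧸ binomialIdeal u v Q c₂ c₁) =
        (Nat.card {β // IsChainStart u v Q β} : ℕ∞) := by
  have := Fintype.ofFinite {β // IsChainStart u v Q β}
  let I := binomialIdeal u v Q c₂ c₁
  have hker : LinearMap.ker (chainCoords u v Q (-c₂ / c₁)) = I.restrictScalars k := by
    ext f
    exact ⟨fun h => mem_of_chainCoords_eq_zero hi hc₁ hc₂ h, fun h => chainCoords_eq_zero hi hc₁ h⟩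
  let e : (MvPolynomial (Fin m) k ⧸ I) ≃ₗ[k] ({β // IsChainStart u v Q β} → k) :=
    (Submodule.quotEquivOfEq _ _ hker.symm : (MvPolynomial (Fin m) k ⧸ I.restrictScalars k) ≃ₗ[k] _)
      ≪≫ₗ LinearMap.quotKerEquivOfSurjective _ (chainCoords_surjective hi _)
  have hfin : Module.Finite k (MvPolynomial (Fin m) k ⧸ I) := Module.Finite.equiv e.symm
  have hN : IsNoetherian (MvPolynomial (Fin m) k) (MvPolynomial (Fin m) k ⧸ I) :=
    isNoetherian_of_tower k inferInstance
  have hA : IsArtinian (MvPolynomial (Fin m) k) (MvPolynomial (Fin m) k ⧸ I) :=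
    isArtinian_of_tower k inferInstance
  rw [length_eq_of_nilpotent (isFiniteLength_iff_isNoetherian_isArtinian.2 ⟨hN, hA⟩),
    e.length_eq, Module.length_eq_finrank, Module.finrank_pi, Nat.card_eq_fintype_card]
  refine fun l => ⟨Q, fun x => ?_⟩
  obtain ⟨f, rfl⟩ := Ideal.Quotient.mk_surjective x
  rw [← Ideal.Quotient.mk_eq_mk, ← Submodule.Quotient.mk_smul, Submodule.Quotient.mk_eq_zero,
    smul_eq_mul]
  exact Ideal.mul_mem_right _ _ (Ideal.mem_sup_left (Ideal.subset_span ⟨l, rfl⟩))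

end Chains

end BinomialHK

namespace BinomialHK

/-! ### Counting chain starts variable by variable -/

section Counting

/-- The points `β` of the box `[0, Q)^len`, in the variables at the positions `p, …, p + len - 1`,
that start a chain inside the box, where only the first `c` steps are taken into account. -/
def StartsWithin (u v : ℕ → ℕ) (Q p len c : ℕ) (β : Fin len → Fin Q) : Prop :=
  (∃ i : Fin len, (β i : ℕ) < v (p + i)) ∧
    ∀ j ≤ c,
      (∀ l < j, ∀ i : Fin len, (u (p + i) : ℤ) ≤ (β i : ℕ) + l * ((v (p + i) : ℤ) - u (p + i))) →
      ∀ i : Fin len, ((β i : ℕ) : ℤ) + j * ((v (p + i) : ℤ) - u (p + i)) < Q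

open Classical in
/-- The number of points `β` with `StartsWithin u v Q p len c β`. -/
noncomputable def startCount (u v : ℕ → ℕ) (Q p len c : ℕ) : ℤ :=
  ∑ β : Fin len → Fin Q, if StartsWithin u v Q p len c β then 1 else 0

variable {u v : ℕ → ℕ} {Q p len c : ℕ}

theorem startsWithin_cons_of_lt (hvu : v p ≤ u p) {x : Fin Q} (hx : (x : ℕ) < v p)
    (β : Fin len → Fin Q) : StartsWithin u v Q p (len + 1) c (Fin.cons x β) := by
  refine ⟨⟨0, by simpa using hx⟩, fun j _ hj i => ?_⟩
  cases j with
  | zero => simp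
  | succ j =>
    have := hj 0 (by omega) 0
    simp at this
    omega

/-- Since u = v + a, a chain can make j steps in this variable exactly if ja ≤ x - v. The exponent
never rises, so the upper bound Q costs nothing, and the variable acts only as a cap on the number
of steps. -/
theorem startsWithin_cons_neg (hvu : v p < u p) {x : Fin Q} (hx : v p ≤ (x : ℕ))
    (β : Fin len → Fin Q) : StartsWithin u v Q p (len + 1) c (Fin.cons x β) ↔
      StartsWithin u v Q (p + 1) len (min c ((x - v p) / (u p - v p))) β := by
  have ha : 0 < u p - v p := by omega
  have hstep : ∀ j : ℕ, (∀ l < j, (u p : ℤ) ≤ (x : ℕ) + l * ((v p : ℤ) - u p)) ↔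
      j ≤ (x - v p) / (u p - v p) := by
    intro j
    rw [Nat.le_div_iff_mul_le ha]
    constructor
    · intro h
      cases j with
      | zero => simp
      | succ j =>
        have := h j (by omega)
        zify [hx, hvu.le]
        linarith
    · intro h l hl
      zify [hx, hvu.le] at h
      have : ((l : ℤ) + 1) * ((u p : ℤ) - v p) ≤ j * ((u p : ℤ) - v p) := by
        apply mul_le_mul_of_nonneg_right <;> omega
      linarith
  have hsucc : ∀ i : Fin len, p + ((i : ℕ) + 1) = p + 1 + i := fun i => by omega
  unfold StartsWithin
  refine and_congr ?_ ?_
  · rw [Fin.exists_fin_succ]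
    simp only [Fin.cons_zero, Fin.cons_succ, Fin.val_succ, Fin.val_zero, hsucc, add_zero]
    constructor
    · rintro (h | h)
      · omega
      · exact h
    · exact Or.inr
  · simp only [Fin.forall_fin_succ, Fin.cons_zero, Fin.cons_succ, Fin.val_succ, Fin.val_zero,
      hsucc, add_zero, forall_and, le_min_iff, hstep]
    constructor
    · intro h j hj h'
      exact h.2 j hj.1 ⟨hj.2, h'⟩
    · intro h
      refine ⟨fun j hj h' => ?_, fun j hj h' => h j ⟨hj, h'.1⟩ h'.2⟩
      have h₁ : (j : ℤ) * ((v p : ℤ) - u p) ≤ 0 :=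
        mul_nonpos_of_nonneg_of_nonpos (by omega) (by omega)
      have := x.2
      omega

theorem startsWithin_cons_zero (hvu : v p = u p) {x : Fin Q} (hx : v p ≤ (x : ℕ))
    (β : Fin len → Fin Q) : StartsWithin u v Q p (len + 1) c (Fin.cons x β) ↔
      StartsWithin u v Q (p + 1) len c β := by
  have hsucc : ∀ i : Fin len, p + ((i : ℕ) + 1) = p + 1 + i := fun i => by omega
  have hx' : (u p : ℤ) ≤ (x : ℕ) := by omega
  have hxQ : ((x : ℕ) : ℤ) < Q := by omega
  unfold StartsWithin
  refine and_congr ?_ ?_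
  · rw [Fin.exists_fin_succ]
    simp only [Fin.cons_zero, Fin.cons_succ, Fin.val_succ, Fin.val_zero, hsucc, add_zero]
    constructor
    · rintro (h | h)
      · omega
      · exact h
    · exact Or.inr
  · simp only [Fin.forall_fin_succ, Fin.cons_zero, Fin.cons_succ, Fin.val_succ, Fin.val_zero,
      hsucc, add_zero, hvu, sub_self, mul_zero, hx', hxQ, true_and]

-- Slicing by the exponent x of the first variable. If x < v ≤ u, there is neither a predecessor nor
-- a step, so all points of the slice count; `T` is indexed by x - v.
open Classical in
theorem startCount_succ (hvu : v p ≤ u p) (hv : v p ≤ Q) (T : ℕ → ℤ)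
    (hT : ∀ x : Fin Q, v p ≤ (x : ℕ) →
      (∑ β : Fin len → Fin Q,
        if StartsWithin u v Q p (len + 1) c (Fin.cons x β) then (1 : ℤ) else 0) = T (x - v p)) :
    startCount u v Q p (len + 1) c = v p * (Q : ℤ) ^ len + ∑ y ∈ Finset.range (Q - v p), T y := by
  have h₁ : startCount u v Q p (len + 1) c = ∑ x : Fin Q, ∑ β : Fin len → Fin Q,
      if StartsWithin u v Q p (len + 1) c (Fin.cons x β) then (1 : ℤ) else 0 := by
    rw [startCount, ← (Fin.consEquiv fun _ => Fin Q).sum_comp, Fintype.sum_prod_type]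
    rfl
  have h₂ : ∀ x : Fin Q, (∑ β : Fin len → Fin Q,
      if StartsWithin u v Q p (len + 1) c (Fin.cons x β) then (1 : ℤ) else 0) =
        (fun x : ℕ => if x < v p then (Q : ℤ) ^ len else T (x - v p)) x := by
    intro x
    by_cases hx : (x : ℕ) < v p
    · simp [hx, startsWithin_cons_of_lt hvu hx]
    · simp only [hx, if_false]
      exact hT x (by omega)
  rw [h₁, Finset.sum_congr rfl fun x _ => h₂ x, Fin.sum_univ_eq_sum_range
    (fun x : ℕ => if x < v p then (Q : ℤ) ^ len else T (x - v p))]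
  have h₃ : Finset.range Q = Finset.range (v p + (Q - v p)) := by rw [Nat.add_sub_cancel' hv]
  rw [h₃, Finset.sum_range_add]
  congr 1
  · rw [Finset.sum_congr rfl fun x hx => if_pos (Finset.mem_range.1 hx)]
    simp
  · exact Finset.sum_congr rfl fun y _ => by simp

theorem startCount_zero_diff (hvu : v p = u p) (hv : v p ≤ Q) :
    startCount u v Q p (len + 1) c =
      (Q - v p) * startCount u v Q (p + 1) len c + v p * (Q : ℤ) ^ len := by
  rw [startCount_succ hvu.le hv (fun _ => startCount u v Q (p + 1) len c)]
  · simp only [Finset.sum_const, Finset.card_range, nsmul_eq_mul]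
    push_cast [hv]
    ring
  · intro x hx
    classical
    exact Finset.sum_congr rfl fun β _ => if_congr (startsWithin_cons_zero hvu hx β) rfl rfl

theorem sum_range_mul_div (g : ℕ → ℤ) {a : ℕ} (ha : 0 < a) (c : ℕ) :
    ∑ y ∈ Finset.range (a * c), g (y / a) = a * ∑ l ∈ Finset.range c, g l := by
  induction c with
  | zero => simp
  | succ c ih =>
    rw [mul_add, mul_one, Finset.sum_range_add, ih, Finset.sum_range_succ, mul_add]
    congr 1
    rw [Finset.sum_congr rfl fun y hy => by
      rw [Nat.mul_add_div ha, Nat.div_eq_of_lt (Finset.mem_range.1 hy), add_zero]]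
    simp

/-- Each quotient l < c is taken a times, and the remaining d terms are capped at c. -/
theorem sum_range_min_div (g : ℕ → ℤ) {a : ℕ} (ha : 0 < a) (c d : ℕ) :
    ∑ y ∈ Finset.range (a * c + d), g (min c (y / a)) =
      a * ∑ l ∈ Finset.range c, g l + d * g c := by
  rw [Finset.sum_range_add, ← sum_range_mul_div g ha]
  congr 1
  · refine Finset.sum_congr rfl fun y hy => ?_
    have : y / a < c := Nat.div_lt_of_lt_mul (Finset.mem_range.1 hy)
    rw [min_eq_right this.le]
  · rw [Finset.sum_congr rfl fun y _ => by
      rw [Nat.mul_add_div ha, min_eq_left (Nat.le_add_right c _)]]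
    simp

theorem startCount_neg_diff (hvu : v p < u p) (hv : v p ≤ Q)
    (hc : (u p - v p) * c ≤ Q - v p) :
    startCount u v Q p (len + 1) c =
      v p * (Q : ℤ) ^ len
        + ((u p : ℤ) - v p) * ∑ l ∈ Finset.range c, startCount u v Q (p + 1) len l
        + (Q - v p - ((u p : ℤ) - v p) * c) * startCount u v Q (p + 1) len c := by
  rw [startCount_succ hvu.le hv
    (fun y => startCount u v Q (p + 1) len (min c (y / (u p - v p))))]
  · have h := sum_range_min_div (startCount u v Q (p + 1) len) (a := u p - v p) (by omega) c
      (Q - v p - (u p - v p) * c)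
    rw [Nat.add_sub_cancel' hc] at h
    rw [h]
    push_cast [hv, hvu.le, hc]
    ring
  · intro x hx
    classical
    exact Finset.sum_congr rfl fun β _ => if_congr (startsWithin_cons_neg hvu hx β) rfl rfl

/-- Steps after the `K`-th one are impossible if the exponent of the first variable is too
small. -/
theorem startsWithin_iff_of_le {K : ℕ}
    (hK : (Q : ℤ) - u p ≤ K * ((u p : ℤ) - v p)) (β : Fin (len + 1) → Fin Q) :
    (∀ c, StartsWithin u v Q p (len + 1) c β) ↔ StartsWithin u v Q p (len + 1) K β := by
  refine ⟨fun h => h K, fun h c => ⟨h.1, fun j _ hj => h.2 j ?_ hj⟩⟩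
  by_contra hlt
  have h₁ := hj K (by omega) 0
  have h₂ := (β 0).2
  simp only [Fin.val_zero, add_zero] at h₁
  have h₃ : (K : ℤ) * ((v p : ℤ) - u p) = -(K * ((u p : ℤ) - v p)) := by ring
  omega

theorem sum_prod_indicator (P : Fin len → Fin Q → Prop) [∀ i x, Decidable (P i x)] :
    (∑ β : Fin len → Fin Q, if ∀ i, P i (β i) then (1 : ℤ) else 0) =
      ∏ i, ∑ x, if P i x then (1 : ℤ) else 0 := by
  rw [Finset.prod_univ_sum, Fintype.piFinset_univ]
  refine Finset.sum_congr rfl fun β _ => ?_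
  rw [Finset.prod_boole]
  simp

theorem sum_indicator_interval (A : ℕ) (d : ℤ) (hd : 0 ≤ d) :
    (∑ x : Fin Q, if A ≤ (x : ℕ) ∧ ((x : ℕ) : ℤ) + d < Q then (1 : ℤ) else 0) =
      max 0 (Q - d - A) := by
  lift d to ℕ using hd
  rw [Fin.sum_univ_eq_sum_range (fun x : ℕ => if A ≤ x ∧ (x : ℤ) + d < Q then (1 : ℤ) else 0),
    Finset.sum_boole]
  have : (Finset.range Q).filter (fun x : ℕ => A ≤ x ∧ (x : ℤ) + d < Q) =
      Finset.Ico A (Q - d) := by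
    ext x
    simp only [Finset.mem_filter, Finset.mem_range, Finset.mem_Ico]
    omega
  rw [this, Nat.card_Ico]
  omega

/-- No exponent decreases, so once the first step is possible all are, and the box condition is
strongest after the last one. -/
theorem startsWithin_pos_diff (hvu : ∀ i < len, u (p + i) ≤ v (p + i)) (β : Fin len → Fin Q) :
    StartsWithin u v Q p len c β ↔ (∃ i : Fin len, (β i : ℕ) < v (p + i)) ∧
      ((∀ i : Fin len, u (p + i) ≤ (β i : ℕ)) →
        ∀ i : Fin len, ((β i : ℕ) : ℤ) + c * ((v (p + i) : ℤ) - u (p + i)) < Q) := by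
  refine and_congr_right fun _ => ⟨fun h hu => h c le_rfl fun l _ i => ?_, fun h j hj hj' i => ?_⟩
  · have h₁ : (0 : ℤ) ≤ l * ((v (p + i) : ℤ) - u (p + i)) :=
      mul_nonneg (by omega) (by have := hvu i i.2; omega)
    have := hu i
    omega
  · cases j with
    | zero => simp
    | succ j =>
      have h₁ := h (fun i => by simpa using hj' 0 (by omega) i) i
      have h₂ : ((j + 1 : ℕ) : ℤ) * ((v (p + i) : ℤ) - u (p + i)) ≤
          c * ((v (p + i) : ℤ) - u (p + i)) :=
        mul_le_mul_of_nonneg_right (by omega) (by have := hvu i i.2; omega)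
      omega

/-- A point not ≥ u cannot move and always counts, since u ≤ v. A point ≥ u counts if it stays in
the box after c steps and is not ≥ v. This gives the two differences of products. -/
theorem startCount_pos_diff (hvu : ∀ i < len, u (p + i) ≤ v (p + i))
    (hv : ∀ i < len, v (p + i) ≤ Q) :
    startCount u v Q p len c = (Q : ℤ) ^ len
      - ∏ i ∈ Finset.range len, ((Q : ℤ) - u (p + i))
      + ∏ i ∈ Finset.range len,
          max 0 ((Q : ℤ) - c * ((v (p + i) : ℤ) - u (p + i)) - u (p + i))
      - ∏ i ∈ Finset.range len,
          max 0 ((Q : ℤ) - c * ((v (p + i) : ℤ) - u (p + i)) - v (p + i)) := by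
  classical
  have hΔ : ∀ i : Fin len, (0 : ℤ) ≤ c * ((v (p + i) : ℤ) - u (p + i)) := fun i =>
    mul_nonneg (by omega) (by have := hvu i i.2; omega)
  have hcount : ∀ w : ℕ → ℕ, (∑ β : Fin len → Fin Q,
      if ∀ i : Fin len, w (p + i) ≤ (β i : ℕ) ∧
        ((β i : ℕ) : ℤ) + c * ((v (p + i) : ℤ) - u (p + i)) < Q then (1 : ℤ) else 0) =
      ∏ i ∈ Finset.range len,
        max 0 ((Q : ℤ) - c * ((v (p + i) : ℤ) - u (p + i)) - w (p + i)) := by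
    intro w
    rw [sum_prod_indicator (fun (i : Fin len) (x : Fin Q) => w (p + i) ≤ (x : ℕ) ∧
        ((x : ℕ) : ℤ) + c * ((v (p + i) : ℤ) - u (p + i)) < Q),
      ← Fin.prod_univ_eq_prod_range
        (fun i => max 0 ((Q : ℤ) - c * ((v (p + i) : ℤ) - u (p + i)) - w (p + i)))]
    exact Finset.prod_congr rfl fun i _ => sum_indicator_interval _ _ (hΔ i)
  have hu : (∑ β : Fin len → Fin Q,
      if ∀ i : Fin len, u (p + i) ≤ (β i : ℕ) then (1 : ℤ) else 0) =
      ∏ i ∈ Finset.range len, ((Q : ℤ) - u (p + i)) := by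
    rw [sum_prod_indicator (fun (i : Fin len) (x : Fin Q) => u (p + i) ≤ (x : ℕ)),
      ← Fin.prod_univ_eq_prod_range (fun i => (Q : ℤ) - u (p + i))]
    refine Finset.prod_congr rfl fun i _ => ?_
    have h := sum_indicator_interval (Q := Q) (u (p + i)) 0 le_rfl
    have h₁ := hvu i i.2
    have h₂ := hv i i.2
    rw [max_eq_right (by omega), sub_zero] at h
    rw [← h]
    refine Finset.sum_congr rfl fun x _ => ?_
    simp
  have hone : (Q : ℤ) ^ len = ∑ β : Fin len → Fin Q, (1 : ℤ) := by simp
  rw [← hcount u, ← hcount v, ← hu, hone, startCount, ← Finset.sum_sub_distrib,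
    ← Finset.sum_add_distrib, ← Finset.sum_sub_distrib]
  refine Finset.sum_congr rfl fun β _ => ?_
  simp only [startsWithin_pos_diff hvu, forall_and]
  have hvu' : (∀ i : Fin len, v (p + i) ≤ (β i : ℕ)) → ∀ i : Fin len, u (p + i) ≤ (β i : ℕ) :=
    fun h i => (hvu i i.2).trans (h i)
  have hnot : (∃ i : Fin len, (β i : ℕ) < v (p + i)) ↔
      ¬ ∀ i : Fin len, v (p + i) ≤ (β i : ℕ) := by push Not; rfl
  simp only [hnot]
  by_cases h₁ : ∀ i : Fin len, u (p + i) ≤ (β i : ℕ)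
  · by_cases h₂ : ∀ i : Fin len, v (p + i) ≤ (β i : ℕ)
    · simp only [h₁, h₂, implies_true, not_true, false_and, if_false, if_true, true_and]; ring
    · simp only [h₁, h₂, implies_true, not_false_iff, true_and, if_true, true_imp_iff,
        false_and, if_false]; ring
  · have h₂ : ¬ ∀ i : Fin len, v (p + i) ≤ (β i : ℕ) := fun h => h₁ (hvu' h)
    simp only [h₁, h₂, not_false_iff, true_and, false_and, if_false, false_imp_iff, if_true]
    ring

end Counting

end BinomialHK

/-! ### The integers of the formula as counts of chain starts -/

namespace BinomialHK

theorem natCard_isChainStart {u v : ℕ → ℕ} {Q m K : ℕ} (u' v' : Fin m →₀ ℕ)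
    (hu : ∀ i, u' i = u i) (hv : ∀ i, v' i = v i) (hm : 0 < m)
    (hK : (Q : ℤ) - u 0 ≤ K * ((u 0 : ℤ) - v 0)) :
    (Nat.card {β // IsChainStart u' v' Q β} : ℤ) = startCount u v Q 0 m K := by
  classical
  obtain ⟨len, rfl⟩ : ∃ len, m = len + 1 := ⟨m - 1, by omega⟩
  have hiff : ∀ β : Fin (len + 1) → Fin Q, StartsWithin u v Q 0 (len + 1) K β ↔
      IsChainStart u' v' Q (Finsupp.equivFunOnFinite.symm fun i => (β i : ℕ)) := by
    intro β
    rw [← startsWithin_iff_of_le hK]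
    simp only [StartsWithin, IsChainStart, hu, hv, zero_add, Finsupp.equivFunOnFinite_symm_apply_apply]
    exact ⟨fun h => ⟨(h 0).1, fun j => (h j).2 j le_rfl⟩, fun h c => ⟨h.1, fun j _ => h.2 j⟩⟩
  let e : {β : Fin (len + 1) → Fin Q // StartsWithin u v Q 0 (len + 1) K β} ≃
      {β // IsChainStart u' v' Q β} :=
    { toFun := fun β => ⟨_, (hiff β.1).1 β.2⟩
      invFun := fun β => ⟨fun i => ⟨β.1 i, β.2.lt i⟩, (hiff _).2 (by
        convert β.2
        ext i
        simp)⟩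
      left_inv := fun β => by ext i; simp
      right_inv := fun β => by ext i; simp }
  rw [← Nat.card_congr e, startCount, Finset.sum_boole, Nat.card_eq_fintype_card,
    Fintype.card_subtype]

namespace Exponents

variable {m : ℕ} (B : Exponents m) (Q : ℕ)

/-! ### The exponents as functions of the position -/

/-- The exponent in `[2]` of the variable at position `j`. -/
def exp₂ (j : ℕ) : ℕ := if h : j < m then B.e₂ ⟨j, h⟩ else 0

/-- The exponent in `[1]` of the variable at position `j`. -/
def exp₁ (j : ℕ) : ℕ := if h : j < m then B.e₁ ⟨j, h⟩ else 0

theorem expMax_eq (j : ℕ) : B.expMax j = max (B.exp₂ j : ℤ) (B.exp₁ j) := by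
  unfold expMax exp₂ exp₁
  split_ifs <;> simp

theorem expMin_eq (j : ℕ) : B.expMin j = min (B.exp₂ j : ℤ) (B.exp₁ j) := by
  unfold expMin exp₂ exp₁
  split_ifs <;> simp

theorem diff_eq (j : ℕ) : B.diff j = (B.exp₁ j : ℤ) - B.exp₂ j := by
  unfold diff exp₂ exp₁ Δ
  split_ifs <;> simp

theorem expMin_le_expMax (j : ℕ) : B.expMin j ≤ B.expMax j := by
  rw [expMin_eq, expMax_eq]
  exact min_le_max

theorem r_add_s_eq :
    B.r + B.s = (Finset.univ.filter fun i => B.Δ i ≤ 0).card := by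
  rw [r, s, ← Finset.card_union_of_disjoint]
  · congr 1
    ext i
    simp [le_iff_lt_or_eq]
  · rw [Finset.disjoint_filter]
    intro i _ h
    exact h.ne

theorem r_add_s_le : B.r + B.s ≤ m := by
  rw [r_add_s_eq]
  exact (Finset.card_le_univ _).trans_eq (Fintype.card_fin m)

theorem r_add_s_add_t : B.r + B.s + B.t = m := by
  have := B.r_add_s_le
  unfold t
  omega

variable {B Q}

/-- Monotonicity of Δ makes the indices satisfying a downward closed condition an initial segment,
whose end is its cardinality. -/
theorem lt_card_filter_iff {P : ℤ → Prop} [DecidablePred P] (hP : ∀ x y, x ≤ y → P y → P x)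
    (hΔ : Monotone B.Δ) (i : Fin m) :
    (i : ℕ) < (Finset.univ.filter fun i => P (B.Δ i)).card ↔ P (B.Δ i) := by
  constructor
  · intro h
    by_contra hi
    have hsub : (Finset.univ.filter fun i => P (B.Δ i)) ⊆ Finset.Iio i := by
      intro j hj
      rw [Finset.mem_Iio]
      by_contra hij
      exact hi (hP _ _ (hΔ (not_lt.1 hij)) (Finset.mem_filter.1 hj).2)
    have := Finset.card_le_card hsub
    rw [Fin.card_Iio] at this
    omega
  · intro h
    have hsub : Finset.Iic i ⊆ (Finset.univ.filter fun i => P (B.Δ i)) := by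
      intro j hj
      exact Finset.mem_filter.2 ⟨Finset.mem_univ _, hP _ _ (hΔ (Finset.mem_Iic.1 hj)) h⟩
    have := Finset.card_le_card hsub
    rw [Fin.card_Iic] at this
    omega

theorem lt_r_iff (hΔ : Monotone B.Δ) {j : ℕ} (hj : j < m) : j < B.r ↔ B.exp₁ j < B.exp₂ j := by
  have h := lt_card_filter_iff (P := fun x => x < 0) (fun x y h h' => h.trans_lt h') hΔ ⟨j, hj⟩
  have h' := B.diff_eq j
  rw [diff, dif_pos hj] at h'
  rw [h'] at h
  exact h.trans (by omega)

theorem lt_r_add_s_iff (hΔ : Monotone B.Δ) {j : ℕ} (hj : j < m) :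
    j < B.r + B.s ↔ B.exp₁ j ≤ B.exp₂ j := by
  have h := lt_card_filter_iff (P := fun x => x ≤ 0) (fun x y h h' => h.trans h') hΔ ⟨j, hj⟩
  have h' := B.diff_eq j
  rw [diff, dif_pos hj] at h'
  rw [h', ← r_add_s_eq] at h
  exact h.trans (by omega)

theorem exp₁_lt_exp₂ (hΔ : Monotone B.Δ) {j : ℕ} (hj : j < B.r) : B.exp₁ j < B.exp₂ j :=
  (lt_r_iff hΔ (by have := B.r_add_s_le; omega)).1 hj

theorem exp₁_eq_exp₂ (hΔ : Monotone B.Δ) {j : ℕ} (hj : B.r ≤ j) (hj' : j < B.r + B.s) :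
    B.exp₁ j = B.exp₂ j := by
  have hm : j < m := by have := B.r_add_s_le; omega
  have h₁ := lt_r_iff hΔ hm
  have h₂ := lt_r_add_s_iff hΔ hm
  omega

theorem exp₂_lt_exp₁ (hΔ : Monotone B.Δ) {j : ℕ} (hj : B.r + B.s ≤ j) (hj' : j < m) :
    B.exp₂ j < B.exp₁ j := by
  have h₂ := lt_r_add_s_iff hΔ hj'
  omega

theorem Admissible.exp₂_lt (h : B.Admissible Q) (hQ : 0 < Q) (j : ℕ) : B.exp₂ j < Q := by
  unfold exp₂
  split_ifs
  · exact h.1 _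
  · exact hQ

theorem Admissible.exp₁_le (h : B.Admissible Q) (j : ℕ) : B.exp₁ j ≤ Q := by
  unfold exp₁
  split_ifs
  · exact h.2.1 _
  · exact Nat.zero_le _

/-! ### The negative difference variables -/

section Neg

variable {i : ℕ}

theorem NMax_eq (hΔ : Monotone B.Δ) (hi : 1 ≤ i) (hir : i ≤ B.r) : B.NMax i = B.exp₂ (B.r - i) := by
  have := exp₁_lt_exp₂ hΔ (j := B.r - i) (by omega)
  rw [NMax, expMax_eq]
  omega

theorem NMin_eq (hΔ : Monotone B.Δ) (hi : 1 ≤ i) (hir : i ≤ B.r) : B.NMin i = B.exp₁ (B.r - i) := by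
  have := exp₁_lt_exp₂ hΔ (j := B.r - i) (by omega)
  rw [NMin, expMin_eq]
  omega

theorem a_eq : B.a i = (B.exp₂ (B.r - i) : ℤ) - B.exp₁ (B.r - i) := by
  rw [a, diff_eq]
  ring

theorem a_pos (hΔ : Monotone B.Δ) (hi : 1 ≤ i) (hir : i ≤ B.r) : 0 < B.a i := by
  have := exp₁_lt_exp₂ hΔ (j := B.r - i) (by omega)
  rw [a_eq]
  omega

theorem NMax_eq_add (hΔ : Monotone B.Δ) (hi : 1 ≤ i) (hir : i ≤ B.r) : B.NMax i = B.a i + B.b i := by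
  rw [b, NMax_eq hΔ hi hir, NMin_eq hΔ hi hir, a_eq]
  ring

theorem b_nonneg : 0 ≤ B.b i := by
  rw [b, NMin, expMin_eq]
  omega

theorem y_spec (ha : 0 < B.a i) (hpos : 0 < B.b i - B.rem Q i) :
    B.a i ∣ B.y Q i ∧ B.b i - B.rem Q i ≤ B.y Q i ∧ B.y Q i < B.b i - B.rem Q i + B.a i := by
  set S := {z : ℕ | 0 < z ∧ B.b i - B.rem Q i ≤ z ∧ B.a i ∣ z} with hS
  obtain ⟨A, hA⟩ := Int.eq_ofNat_of_zero_le ha.le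
  obtain ⟨x, hx⟩ := Int.eq_ofNat_of_zero_le hpos.le
  have hne : S.Nonempty := by
    refine ⟨x * A, ?_, ?_, ?_⟩
    · exact Nat.mul_pos (by omega) (by omega)
    · rw [hx]
      push_cast
      nlinarith
    · rw [hA]
      push_cast
      exact Dvd.intro_left _ rfl
  have hmem := Nat.sInf_mem hne
  have hy : B.y Q i = ((sInf S : ℕ) : ℤ) := rfl
  rw [hy]
  refine ⟨hmem.2.2, hmem.2.1, ?_⟩
  by_contra hlt
  have hmem' : sInf S - A ∈ S := by
    have h₁ := hmem.2.1
    refine ⟨by omega, by omega, ?_⟩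
    rw [Nat.cast_sub (by omega), ← hA]
    exact dvd_sub_self_right.2 hmem.2.2
  have := Nat.sInf_le hmem'
  have h₀ := hmem.1
  omega

/-- Division of `Q - 1 - b_i` by `a_i`: the quotient is `M_{a_i} - p_{a_i}` and the remainder is
`E_i`. -/
theorem div_spec (ha : 0 < B.a i) :
    (Q : ℤ) - 1 - B.b i = B.a i * (B.Mq Q i - B.pa Q i) + B.E Q i ∧
      0 ≤ B.E Q i ∧ B.E Q i < B.a i := by
  have hdiv : (Q : ℤ) - 1 = B.a i * B.Mq Q i + B.rem Q i := (Int.mul_ediv_add_emod _ _).symm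
  have h₀ : 0 ≤ B.rem Q i := Int.emod_nonneg _ ha.ne'
  have h₁ : B.rem Q i < B.a i := Int.emod_lt_of_pos _ ha
  have hb := B.b_nonneg (i := i)
  by_cases hba : B.b i < B.a i
  · by_cases hbr : B.b i ≤ B.rem Q i
    · have hp : B.pa Q i = 0 := by rw [pa, if_pos hba, if_pos hbr]
      have hE : B.E Q i = B.rem Q i - B.b i := by rw [E, if_pos hp]
      rw [hp, hE]
      refine ⟨?_, by omega, by omega⟩
      rw [hdiv]
      ring
    · have hp : B.pa Q i = 1 := by rw [pa, if_pos hba, if_neg hbr]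
      have hE : B.E Q i = B.rem Q i - B.b i + B.a i := by
        rw [E, if_neg (by omega), if_pos hp]
      rw [hp, hE]
      refine ⟨?_, by omega, by omega⟩
      rw [hdiv]
      ring
  · obtain ⟨⟨q, hq⟩, h₂, h₃⟩ := B.y_spec (Q := Q) ha (by omega)
    have hp : B.pa Q i = q := by
      rw [pa, if_neg hba, qa, hq, Int.mul_ediv_cancel_left _ ha.ne']
    have hE : B.E Q i = B.y Q i - (B.b i - B.rem Q i) := by
      rw [E, hp]
      -- Here b ≥ a, but `E` still branches on the value of p. The value 0 is impossible because y ≥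
      -- b - rem > 0, and for the value 1 one has y = a, where both expressions agree.
      split_ifs with hq₀ hq₁
      · rw [hq₀, mul_zero] at hq
        omega
      · rw [hq₁, mul_one] at hq
        omega
      · rfl
    rw [hp, hE, hdiv]
    refine ⟨?_, by omega, by omega⟩
    rw [hq]
    ring

/-- The rounding is vacuous: N_max = a + b makes the division exact, with quotient K_i - 1. -/
theorem kLast_eq (hΔ : Monotone B.Δ) (hi : 1 ≤ i) (hir : i ≤ B.r) : B.kLast Q i = max 1 (B.Mq Q i - B.pa Q i - 1) := by
  have ha := a_pos hΔ hi hir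
  have h := (B.div_spec (Q := Q) ha).1
  have h' : (Q : ℤ) - B.NMax i - 1 - B.E Q i = (B.Mq Q i - B.pa Q i - 1) * B.a i := by
    rw [NMax_eq_add hΔ hi hir]
    linarith
  have ha' : (B.a i : ℚ) ≠ 0 := by exact_mod_cast ha.ne'
  rw [kLast, h', leastPos, Int.cast_mul, mul_div_cancel_right₀ _ ha', Int.ceil_intCast]

/-- Together with `kLast_eq` this says that a_i' is a_i if K_i ≥ 2 and 0 if K_i = 1. -/
theorem a'_eq (hΔ : Monotone B.Δ) (hi : 1 ≤ i) (hir : i ≤ B.r) : B.a' Q i = B.a i * (B.Mq Q i - B.pa Q i - B.kLast Q i) := by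
  have h := (B.div_spec (Q := Q) (a_pos hΔ hi hir)).1
  rw [a', NMax_eq_add hΔ hi hir]
  linarith

theorem Admissible.one_le_quotient (hΔ : Monotone B.Δ) (hi : 1 ≤ i) (hir : i ≤ B.r) (h : B.Admissible Q) (hQ : 0 < Q) :
    1 ≤ B.Mq Q i - B.pa Q i := by
  have ha := a_pos hΔ hi hir
  obtain ⟨h₁, h₂, h₃⟩ := B.div_spec (Q := Q) ha
  have h₄ := h.exp₂_lt hQ (B.r - i)
  have h₅ := NMax_eq_add hΔ hi hir
  rw [NMax_eq hΔ hi hir] at h₅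
  by_contra hlt
  nlinarith

end Neg

/-! ### Closed forms of the recursions for the positive difference variables -/

section Pos

variable (B Q)

theorem Cq_succ {q : ℕ} (hq : q ≤ B.t) : (Q : ℤ) * B.Cq Q (q + 1) = B.Cq Q q := by
  rw [Cq, Cq, ← pow_succ']
  congr 1
  omega

/-- The recursion counts the points of a box with some exponent below `PMin`, that is, the
complement of a smaller box. The next closed forms have the same shape. -/
theorem Aq_eq {q : ℕ} (hq : q ≤ B.t + 1) :
    B.Aq Q q = B.Cq Q q - ∏ x ∈ Finset.Ico q (B.t + 1), ((Q : ℤ) - B.PMin x) := by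
  induction hd : B.t + 1 - q generalizing q with
  | zero =>
    obtain rfl : q = B.t + 1 := by omega
    rw [Aq, if_pos (by omega), Cq]
    simp
  | succ d ih =>
    have hq' : q < B.t + 1 := by omega
    rw [Aq, if_neg (by omega), ih (by omega) (by omega),
      Finset.prod_eq_prod_Ico_succ_bot hq', ← Cq_succ B Q (q := q) (by omega)]
    ring

theorem Dq_eq (M : ℤ) {q : ℕ} (hq : q ≤ B.t + 1) :
    B.Dq Q M q = B.Cq Q q - ∏ x ∈ Finset.Ico q (B.t + 1), ((Q : ℤ) - B.PMin x)
      + ∏ x ∈ Finset.Ico q (B.t + 1), ((Q : ℤ) - B.PMin x - B.minc Q M x) := by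
  induction hd : B.t + 1 - q generalizing q with
  | zero =>
    obtain rfl : q = B.t + 1 := by omega
    rw [Dq, if_pos (by omega), Cq]
    simp
  | succ d ih =>
    have hq' : q < B.t + 1 := by omega
    rw [Dq, if_neg (by omega), ih (by omega) (by omega), Aq_eq B Q (by omega),
      Finset.prod_eq_prod_Ico_succ_bot hq', Finset.prod_eq_prod_Ico_succ_bot hq',
      ← Cq_succ B Q (q := q) (by omega)]
    ring

theorem hP_add_dP (M : ℤ) (q : ℕ) :
    B.hP Q M q + B.dP Q M q = Q - B.PMin q - B.minc Q M q := by
  unfold hP dP sP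
  split_ifs <;> omega

theorem Dtilde_eq (M : ℤ) {q : ℕ} (hq : q ≤ B.t + 1) :
    B.Dtilde Q M q = B.Cq Q q - ∏ x ∈ Finset.Ico q (B.t + 1), ((Q : ℤ) - B.PMin x)
      + ∏ x ∈ Finset.Ico q (B.t + 1), ((Q : ℤ) - B.PMin x - B.minc Q M x)
      - ∏ x ∈ Finset.Ico q (B.t + 1), B.hP Q M x := by
  induction hd : B.t + 1 - q generalizing q with
  | zero =>
    obtain rfl : q = B.t + 1 := by omega
    rw [Dtilde, if_pos (by omega), Cq]
    simp
  | succ d ih =>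
    have hq' : q < B.t + 1 := by omega
    rw [Finset.prod_eq_prod_Ico_succ_bot hq', Finset.prod_eq_prod_Ico_succ_bot hq',
      Finset.prod_eq_prod_Ico_succ_bot hq', ← Cq_succ B Q (q := q) (by omega)]
    have hhd := B.hP_add_dP Q M q
    have hA := B.Aq_eq Q (q := q + 1) (by omega)
    have hD := B.Dq_eq Q M (q := q + 1) (by omega)
    have ih' := @ih (q + 1) (by omega) (by omega)
    rw [Dtilde, if_neg (by omega)]
    split_ifs with hlt
    · rw [ih', hA, hD]
      have hd' : B.dP Q M q = Q - B.PMin q - B.minc Q M q - B.hP Q M q := by linarith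
      rw [hd']
      ring
    -- The cap in `minc` is attained, so the factors at q of the last two products are both zero, as
    -- the second branch of the definition requires.
    · have hmin : B.minc Q M q = Q - B.PMin q := by
        unfold minc at hlt ⊢
        omega
      have hle : B.PMin q ≤ B.PMax q := B.expMin_le_expMax _
      have h0 : B.hP Q M q = 0 := by
        rw [hP, if_neg]
        omega
      rw [hA, h0, hmin]
      ring

theorem frakS_zero (M : ℤ) : B.frakS Q M 0 = B.Dtilde Q M 1 := by
  by_cases ht : B.t = 0
  · rw [frakS, Dtilde, if_pos ht, if_pos (by omega)]
  · rw [frakS, Dtilde, if_neg ht, if_neg (by omega), BP]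
    split_ifs <;> ring

theorem GP_eq {q : ℕ} (hq : q ≤ B.t) :
    B.GP Q q = (Q : ℤ) ^ (B.t - q)
      - ∏ x ∈ Finset.Ico (q + 1) (B.t + 1), ((Q : ℤ) - B.PMax x) := by
  induction hd : B.t - q generalizing q with
  | zero =>
    obtain rfl : q = B.t := by omega
    rw [GP, if_pos le_rfl]
    simp
  | succ d ih =>
    rw [GP, if_neg (by omega), ih (by omega) (by omega),
      Finset.prod_eq_prod_Ico_succ_bot (by omega : q + 1 < B.t + 1),
      show B.t - q - 1 = d by omega, pow_succ]
    ring

variable {B Q}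

theorem prod_Ico_shift (f : ℕ → ℤ) :
    ∏ x ∈ Finset.Ico 1 (B.t + 1), f (B.r + B.s + x - 1) =
      ∏ x ∈ Finset.range B.t, f (B.r + B.s + x) := by
  rw [Finset.prod_Ico_eq_prod_range]
  refine Finset.prod_congr (by simp) fun x _ => ?_
  congr 1
  omega

theorem expMax_pos (hΔ : Monotone B.Δ) {x : ℕ} (hx : x < B.t) :
    B.expMax (B.r + B.s + x) = B.exp₁ (B.r + B.s + x) := by
  have h := B.r_add_s_add_t
  have := exp₂_lt_exp₁ hΔ (j := B.r + B.s + x) (by omega) (by omega)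
  rw [expMax_eq]
  omega

theorem expMin_pos (hΔ : Monotone B.Δ) {x : ℕ} (hx : x < B.t) :
    B.expMin (B.r + B.s + x) = B.exp₂ (B.r + B.s + x) := by
  have h := B.r_add_s_add_t
  have := exp₂_lt_exp₁ hΔ (j := B.r + B.s + x) (by omega) (by omega)
  rw [expMin_eq]
  omega

/-- The minimum in `minc` is what turns Q - u - cΔ into its positive part, and `hP` does the same
for v. -/
theorem startCount_pos (hΔ : Monotone B.Δ) (h : B.Admissible Q) (c : ℕ) :
    startCount B.exp₂ B.exp₁ Q (B.r + B.s) B.t c = B.frakS Q c 0 := by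
  have hm := B.r_add_s_add_t
  rw [frakS_zero, Dtilde_eq B Q c (by omega), startCount_pos_diff
    (fun i hi => (exp₂_lt_exp₁ hΔ (by omega) (by omega)).le) (fun i _ => h.exp₁_le _)]
  have h₁ : ∏ x ∈ Finset.Ico 1 (B.t + 1), ((Q : ℤ) - B.PMin x) =
      ∏ i ∈ Finset.range B.t, ((Q : ℤ) - B.exp₂ (B.r + B.s + i)) := by
    simp only [PMin]
    rw [prod_Ico_shift (fun x => (Q : ℤ) - B.expMin x)]
    exact Finset.prod_congr rfl fun x hx => by rw [expMin_pos hΔ (Finset.mem_range.1 hx)]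
  have hμ : ∀ x ∈ Finset.Ico 1 (B.t + 1), B.minc Q c x = min ((Q : ℤ) - B.exp₂ (B.r + B.s + x - 1))
      (c * ((B.exp₁ (B.r + B.s + x - 1) : ℤ) - B.exp₂ (B.r + B.s + x - 1))) := by
    intro x hx
    rw [Finset.mem_Ico] at hx
    rw [minc, PMin, ΔP, diff_eq, show B.r + B.s + x - 1 = B.r + B.s + (x - 1) by omega,
      expMin_pos hΔ (by omega)]
  have h₂ : ∏ x ∈ Finset.Ico 1 (B.t + 1), ((Q : ℤ) - B.PMin x - B.minc Q c x) =
      ∏ i ∈ Finset.range B.t, max 0 ((Q : ℤ)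
        - c * ((B.exp₁ (B.r + B.s + i) : ℤ) - B.exp₂ (B.r + B.s + i))
          - B.exp₂ (B.r + B.s + i)) := by
    rw [← prod_Ico_shift (fun x => max 0 ((Q : ℤ) - c * ((B.exp₁ x : ℤ) - B.exp₂ x) - B.exp₂ x))]
    refine Finset.prod_congr rfl fun x hx => ?_
    rw [hμ x hx]
    rw [Finset.mem_Ico] at hx
    rw [PMin, show B.r + B.s + x - 1 = B.r + B.s + (x - 1) by omega, expMin_pos hΔ (by omega)]
    generalize (c : ℤ) * _ = d
    omega
  have h₃ : ∏ x ∈ Finset.Ico 1 (B.t + 1), B.hP Q c x =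
      ∏ i ∈ Finset.range B.t, max 0 ((Q : ℤ)
        - c * ((B.exp₁ (B.r + B.s + i) : ℤ) - B.exp₂ (B.r + B.s + i))
          - B.exp₁ (B.r + B.s + i)) := by
    rw [← prod_Ico_shift (fun x => max 0 ((Q : ℤ) - c * ((B.exp₁ x : ℤ) - B.exp₂ x) - B.exp₁ x))]
    refine Finset.prod_congr rfl fun x hx => ?_
    rw [hP, hμ x hx]
    rw [Finset.mem_Ico] at hx
    have := exp₂_lt_exp₁ hΔ (j := B.r + B.s + (x - 1)) (by omega) (by omega)
    rw [PMax, show B.r + B.s + x - 1 = B.r + B.s + (x - 1) by omega, expMax_pos hΔ (by omega)]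
    generalize (c : ℤ) * _ = d
    split_ifs <;> omega
  rw [h₁, h₂, h₃, Cq]
  simp

theorem GP_zero_eq_startCount (hΔ : Monotone B.Δ) (h : B.Admissible Q) :
    B.GP Q 0 = startCount B.exp₂ B.exp₁ Q (B.r + B.s) B.t 0 := by
  have hm := B.r_add_s_add_t
  rw [GP_eq B Q (Nat.zero_le _), startCount_pos_diff
    (fun i hi => (exp₂_lt_exp₁ hΔ (by omega) (by omega)).le) (fun i _ => h.exp₁_le _)]
  have h₁ : ∏ x ∈ Finset.Ico 1 (B.t + 1), ((Q : ℤ) - B.PMax x) =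
      ∏ i ∈ Finset.range B.t, ((Q : ℤ) - B.exp₁ (B.r + B.s + i)) := by
    simp only [PMax]
    rw [prod_Ico_shift (fun x => (Q : ℤ) - B.expMax x)]
    exact Finset.prod_congr rfl fun x hx => by rw [expMax_pos hΔ (Finset.mem_range.1 hx)]
  have h₂ : ∀ i, max 0 ((Q : ℤ) - B.exp₁ i) = Q - B.exp₁ i := fun i => by
    have := h.exp₁_le i
    omega
  have h₃ : ∀ i ∈ Finset.range B.t, max 0 ((Q : ℤ) - B.exp₂ (B.r + B.s + i)) =
      Q - B.exp₂ (B.r + B.s + i) := fun i hi => by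
    rw [Finset.mem_range] at hi
    have := h.exp₁_le (B.r + B.s + i)
    have := exp₂_lt_exp₁ hΔ (j := B.r + B.s + i) (by omega) (by omega)
    omega
  simp only [zero_add, h₁, Nat.cast_zero, zero_mul, sub_zero, h₂, tsub_zero]
  rw [Finset.prod_congr rfl h₃]
  ring

end Pos

/-! ### The zero difference variables -/

section Zero

theorem frakS_eq_startCount (hΔ : Monotone B.Δ) (h : B.Admissible Q) (c : ℕ) {l : ℕ} (hl : l ≤ B.s) :
    B.frakS Q c l = startCount B.exp₂ B.exp₁ Q (B.r + B.s - l) (B.t + l) c := by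
  induction l with
  | zero => exact (startCount_pos hΔ h c).symm
  | succ l ih =>
    have heq := exp₁_eq_exp₂ hΔ (j := B.r + B.s - (l + 1)) (by omega) (by omega)
    rw [← add_assoc, startCount_zero_diff heq (h.exp₁_le _),
      show B.r + B.s - (l + 1) + 1 = B.r + B.s - l by omega, ← ih (by omega), frakS, ZMin,
      expMin_eq, ← heq, min_self]
    ring

theorem GZ_eq_startCount (hΔ : Monotone B.Δ) (h : B.Admissible Q) {l : ℕ} (hl : l ≤ B.s) :
    B.GZ Q (l + 1) = startCount B.exp₂ B.exp₁ Q (B.r + B.s - l) (B.t + l) 0 := by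
  induction l with
  | zero => exact GP_zero_eq_startCount hΔ h
  | succ l ih =>
    have heq := exp₁_eq_exp₂ hΔ (j := B.r + B.s - (l + 1)) (by omega) (by omega)
    rw [← add_assoc, startCount_zero_diff heq (h.exp₁_le _),
      show B.r + B.s - (l + 1) + 1 = B.r + B.s - l by omega, ← ih (by omega), GZ, ZMax,
      expMax_eq, ← heq, max_self]

end Zero

/-! ### The iterative formula counts chains -/

section Count

/-- With cap 0 no step is examined, so a negative variable just splits into exponents below and not
below v. -/
theorem GN_eq_startCount (hΔ : Monotone B.Δ) (h : B.Admissible Q) {i : ℕ} (hi : i ≤ B.r) :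
    B.GN Q (i + 1) = startCount B.exp₂ B.exp₁ Q (B.r - i) (B.t + B.s + i) 0 := by
  induction i with
  | zero =>
    rw [GN, GZ_eq_startCount hΔ h le_rfl]
    simp
  | succ i ih =>
    have hlt := exp₁_lt_exp₂ hΔ (j := B.r - (i + 1)) (by omega)
    rw [← add_assoc, startCount_neg_diff hlt (h.exp₁_le _) (by simp),
      show B.r - (i + 1) + 1 = B.r - i by omega, ← ih (by omega), GN,
      NMin_eq hΔ (by omega) hi]
    simp
    ring

theorem sum_Ioo_sub (f : ℤ → ℤ) (K : ℤ) {c : ℕ} (hc : 1 ≤ c) :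
    ∑ x ∈ Finset.Ioo (K - c) K, f x = ∑ l ∈ Finset.Ico 1 c, f (K - (l : ℕ)) := by
  induction c, hc using Nat.le_induction with
  | base =>
    rw [Finset.Ico_self, Finset.sum_empty, Finset.sum_eq_zero]
    intro x hx
    rw [Finset.mem_Ioo] at hx
    omega
  | succ c hc ih =>
    rw [Finset.sum_Ico_succ_top hc, ← ih]
    have : Finset.Ioo (K - (c + 1 : ℕ)) K = insert (K - (c : ℕ)) (Finset.Ioo (K - c) K) := by
      ext x
      simp only [Finset.mem_Ioo, Finset.mem_insert]
      omega
    rw [this, Finset.sum_insert (by simp), add_comm]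

theorem integral_eq_startCount (hΔ : Monotone B.Δ) (h : B.Admissible Q) {i : ℕ} (hi : i ≤ B.r) {c : ℕ}
    (hc : 1 ≤ c) (hcK : (c : ℤ) ≤ B.Mq Q B.r - B.pa Q B.r) :
    B.integral Q (i + 1) (B.Mq Q B.r - B.pa Q B.r - c) =
      startCount B.exp₂ B.exp₁ Q (B.r - i) (B.t + B.s + i) c := by
  induction i generalizing c with
  | zero =>
    rw [integral, sub_sub_cancel, Φ, frakS_eq_startCount hΔ h c le_rfl]
    simp
  | succ i ih =>
    have hlt := exp₁_lt_exp₂ hΔ (j := B.r - (i + 1)) (by omega)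
    have ha := a_pos hΔ (i := i + 1) (by omega) hi
    obtain ⟨hdiv, hE₀, hE₁⟩ := B.div_spec (Q := Q) ha
    have hmin := NMin_eq hΔ (i := i + 1) (by omega) hi
    have hmax := NMax_eq_add hΔ (i := i + 1) (by omega) hi
    have hae := B.a_eq (i := i + 1)
    have hk := B.kLast_eq (Q := Q) hΔ (i := i + 1) (by omega) hi
    have ha' := B.a'_eq (Q := Q) hΔ (i := i + 1) (by omega) hi
    have hKi := h.2.2 (i + 1) (by omega) hi
    have hle := h.exp₁_le (B.r - (i + 1))
    have hX : B.Xlast Q (i + 1) = B.Mq Q B.r - B.pa Q B.r - (B.Mq Q (i + 1) - B.pa Q (i + 1))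
        + B.kLast Q (i + 1) := by rw [Xlast]; ring
    have hD : B.Da Q (i + 1) = 1 + B.E Q (i + 1) + B.a (i + 1) *
        (B.Mq Q (i + 1) - B.pa Q (i + 1) - (B.Mq Q B.r - B.pa Q B.r)) := by rw [Da]; ring
    set K := B.Mq Q B.r - B.pa Q B.r with hKdef
    set K' := B.Mq Q (i + 1) - B.pa Q (i + 1) with hKdef'
    have hb : B.b (i + 1) = B.exp₁ (B.r - (i + 1)) := hmin
    -- Here minimality of K_r enters: c ≤ K_r ≤ K_i, so the capped range fits below Q.
    have hcc : (B.exp₂ (B.r - (i + 1)) - B.exp₁ (B.r - (i + 1))) * c ≤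
        Q - B.exp₁ (B.r - (i + 1)) := by
      zify [hlt.le, hle]
      rw [← hae, ← hb]
      have : B.a (i + 1) * c ≤ B.a (i + 1) * K' := mul_le_mul_of_nonneg_left (by omega) ha.le
      linarith
    -- The cap l corresponds to the index K - l. The term with l = 0 is split off as G, which
    -- explains its appearance in the constants K_i.
    have hsum : ∑ l ∈ Finset.range c,
        startCount B.exp₂ B.exp₁ Q (B.r - i) (B.t + B.s + i) l =
        B.GN Q (i + 1) + ∑ l ∈ Finset.Ioo (K - c) K, B.integral Q (i + 1) l := by
      rw [sum_Ioo_sub _ _ hc, Finset.range_eq_Ico, Finset.sum_eq_sum_Ico_succ_bot (by omega),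
        GN_eq_startCount hΔ h (by omega)]
      congr 1
      refine Finset.sum_congr rfl fun l hl => ?_
      rw [Finset.mem_Ico] at hl
      exact (ih (by omega) (by omega) (by omega)).symm
    rw [← add_assoc, startCount_neg_diff hlt hle hcc,
      show B.r - (i + 1) + 1 = B.r - i by omega, hsum, ← ih (by omega) hc hcK, ← hae, ← hb,
      integral, hmax, ← b, add_comm B.s B.t]
    -- Now X̃ = K - 1, the index of cap 1, and a' = a, so the term at X̃ is just the last summand of
    -- the sum over caps. The cap c = 1 itself falls in the branch j ≥ X̃.
    by_cases hK' : 2 ≤ K'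
    · have hk' : B.kLast Q (i + 1) = K' - 1 := by rw [hk]; omega
      have hX' : B.Xlast Q (i + 1) = K - 1 := by rw [hX, hk']; ring
      rw [hX']
      by_cases hc2 : 2 ≤ c
      · rw [if_pos (by omega), ← Finset.mul_sum]
        have hIoo : Finset.Ioo (K - c) K = insert (K - 1) (Finset.Ioo (K - c) (K - 1)) := by
          ext x
          simp only [Finset.mem_Ioo, Finset.mem_insert]
          omega
        rw [hIoo, Finset.sum_insert (by simp), ha', hk', hD]
        have hE : B.E Q (i + 1) = (Q : ℤ) - 1 - B.b (i + 1) - B.a (i + 1) * K' := by linarith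
        rw [hE]
        ring
      · obtain rfl : c = 1 := by omega
        rw [if_neg (by simp)]
        have : Finset.Ioo (K - (1 : ℕ)) K = ∅ := by
          ext x
          simp only [Finset.mem_Ioo, Finset.notMem_empty, iff_false]
          omega
        rw [this, Finset.sum_empty]
        push_cast
        ring
    -- Only one step is possible. Then a' = 0, which removes the value at X̃ = 1, the index of cap
    -- 0.
    · have hK1 : K' = 1 := by omega
      have hK2 : K = 1 := by omega
      obtain rfl : c = 1 := by omega
      have hk' : B.kLast Q (i + 1) = 1 := by rw [hk]; omega
      have hX' : B.Xlast Q (i + 1) = 1 := by rw [hX, hk', hK1, hK2]; norm_num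
      rw [hX', if_pos (by rw [hK2]; norm_num), ha', hk', hD, hK1, hK2]
      have hE : B.E Q (i + 1) = (Q : ℤ) - 1 - B.b (i + 1) - B.a (i + 1) := by
        rw [hK1] at hdiv
        linarith
      have : Finset.Ioo (1 - ((1 : ℕ) : ℤ)) 1 = ∅ := by decide
      rw [this, hE]
      push_cast
      simp
      ring

/-- The final formula is one more step of the iteration, evaluated at j = 0. -/
theorem hkFormula_eq_integral (hr : 1 ≤ B.r) (hX : 0 < B.Xlast Q B.r) :
    B.hkFormula Q = B.integral Q (B.r + 1) 0 := by
  obtain ⟨ρ, hρ⟩ : ∃ ρ, B.r = ρ + 1 := ⟨B.r - 1, by omega⟩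
  rw [hkFormula]
  generalize hR : B.r = R at *
  subst hρ
  rw [integral, if_pos hX]
  simp only [zero_mul, add_zero]
  rfl

theorem hkFormula_eq_startCount (hΔ : Monotone B.Δ) (hr : 1 ≤ B.r) (h : B.Admissible Q) (hQ : 0 < Q) :
    B.hkFormula Q = startCount B.exp₂ B.exp₁ Q 0 m (B.Mq Q B.r - B.pa Q B.r).toNat := by
  have hK := h.one_le_quotient hΔ hr le_rfl hQ
  have hk := B.kLast_eq (Q := Q) hΔ hr le_rfl
  have hX : 0 < B.Xlast Q B.r := by
    rw [Xlast]
    omega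
  have hi := integral_eq_startCount hΔ h (le_refl B.r)
    (c := (B.Mq Q B.r - B.pa Q B.r).toNat) (by omega) (by omega)
  rw [Int.toNat_of_nonneg (by omega), sub_self] at hi
  rw [hkFormula_eq_integral hr hX, hi, Nat.sub_self]
  congr 1
  have := B.r_add_s_add_t
  omega

theorem hkLength_eq (hΔ : Monotone B.Δ) {k : Type*} [Field k] {c₂ c₁ : k} (hc₂ : c₂ ≠ 0) (hc₁ : c₁ ≠ 0)
    (hr : 1 ≤ B.r) (h : B.Admissible Q) (hQ : 0 < Q) :
    ∃ L : ℕ, hkLength (B.poly c₂ c₁) Q = (L : ℕ∞) ∧ (L : ℤ) = B.hkFormula Q := by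
  have hm : 0 < m := by
    have := B.r_add_s_le
    omega
  have hlt := exp₁_lt_exp₂ hΔ (j := 0) (by omega)
  have hu : ∀ i : Fin m, B.e₂ i = B.exp₂ i := fun i => by rw [exp₂, dif_pos i.2]
  have hv : ∀ i : Fin m, B.e₁ i = B.exp₁ i := fun i => by rw [exp₁, dif_pos i.2]
  refine ⟨_, length_quotient_binomialIdeal (i := ⟨0, hm⟩) ?_ hc₁ hc₂, ?_⟩
  · simpa [hu, hv] using hlt
  · rw [hkFormula_eq_startCount hΔ hr h hQ]
    -- The variable N_r, at position 0, allows at most K_r steps, so the cap K_r loses nothing.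
    refine natCard_isChainStart _ _ hu hv hm ?_
    obtain ⟨h₁, h₂, h₃⟩ := B.div_spec (Q := Q) (a_pos hΔ hr le_rfl)
    have hK := h.one_le_quotient hΔ hr le_rfl hQ
    have hb : B.b B.r = B.exp₁ 0 := by
      rw [b, NMin_eq hΔ hr le_rfl, Nat.sub_self]
    have ha := B.a_eq (i := B.r)
    rw [Nat.sub_self] at ha
    rw [Int.toNat_of_nonneg (by omega), ← ha]
    rw [mul_comm]
    omega

end Count

end Exponents

end BinomialHK

namespace BinomialHK

namespace Exponents

variable {m : ℕ} {B : Exponents m} {Q : ℕ}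

/-! ### The expanded form -/

section Expanded

theorem Icc_zero_split {X R : ℤ} (hX : 0 ≤ X) (hXR : X ≤ R) (f : ℤ → ℤ) :
    ∑ j ∈ Finset.Icc 0 R, f j =
      ∑ j ∈ Finset.Ico 0 X, f j + f X + ∑ j ∈ Finset.Icc (X + 1) R, f j := by
  have h : Finset.Icc 0 R = (Finset.Ico 0 X ∪ {X}) ∪ Finset.Icc (X + 1) R := by
    ext x
    simp only [Finset.mem_union, Finset.mem_Icc, Finset.mem_Ico, Finset.mem_singleton]
    omega
  rw [h, Finset.sum_union, Finset.sum_union, Finset.sum_singleton]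
  · simp
  · rw [Finset.disjoint_left]
    intro x
    simp only [Finset.mem_union, Finset.mem_Icc, Finset.mem_Ico, Finset.mem_singleton]
    omega

theorem sum_Ico_zero_eq {X : ℤ} (hX : 0 < X) (f : ℤ → ℤ) :
    ∑ j ∈ Finset.Ico 0 X, f j = f 0 + ∑ j ∈ Finset.Icc 1 (X - 1), f j := by
  have h : Finset.Ico 0 X = insert 0 (Finset.Icc 1 (X - 1)) := by
    ext x
    simp only [Finset.mem_insert, Finset.mem_Icc, Finset.mem_Ico]
    omega
  rw [h, Finset.sum_insert (by simp)]

/-- Substitution of one step of the iteration into a linear combination of its values. -/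
theorem sum_mul_step {X R : ℤ} (hX : 0 ≤ X) (hXR : X ≤ R) (D a a' e κ : ℤ) (c c' I J : ℤ → ℤ)
    (hJ : ∀ j < X, J j = (D + j * a) * I j + ∑ l ∈ Finset.Ioo j X, a * I l + a' * I X + κ)
    (hJ' : ∀ j, X ≤ j → J j = e * I j + κ)
    (hc : ∀ j, 0 ≤ j → j < X → c' j = (D + j * a) * c j + a * ∑ l ∈ Finset.Ico 0 j, c l)
    (hcX : c' X = a' * (∑ l ∈ Finset.Ico 0 X, c l) + e * c X)
    (hc' : ∀ j, X < j → c' j = e * c j) :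
    ∑ j ∈ Finset.Icc 0 R, c j * J j =
      ∑ j ∈ Finset.Icc 0 R, c' j * I j + κ * ∑ j ∈ Finset.Icc 0 R, c j := by
  -- Transposing the sum: the integral at l receives a contribution from every j < l.
  have hswap : ∑ j ∈ Finset.Ico 0 X, ∑ l ∈ Finset.Ioo j X, c j * (a * I l) =
      ∑ l ∈ Finset.Ico 0 X, ∑ j ∈ Finset.Ico 0 l, c j * (a * I l) := by
    refine Finset.sum_comm' fun x y => ?_
    simp only [Finset.mem_Ico, Finset.mem_Ioo]
    omega
  have h₁ : ∑ j ∈ Finset.Ico 0 X, c j * J j =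
      ∑ j ∈ Finset.Ico 0 X, c' j * I j + a' * (∑ l ∈ Finset.Ico 0 X, c l) * I X
        + κ * ∑ j ∈ Finset.Ico 0 X, c j := by
    have h₂ : ∑ j ∈ Finset.Ico 0 X, c j * J j = ∑ j ∈ Finset.Ico 0 X, (D + j * a) * c j * I j
        + ∑ j ∈ Finset.Ico 0 X, ∑ l ∈ Finset.Ioo j X, c j * (a * I l)
        + a' * (∑ l ∈ Finset.Ico 0 X, c l) * I X + κ * ∑ j ∈ Finset.Ico 0 X, c j := by
      rw [Finset.mul_sum, Finset.mul_sum, Finset.sum_mul, ← Finset.sum_add_distrib,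
        ← Finset.sum_add_distrib, ← Finset.sum_add_distrib]
      refine Finset.sum_congr rfl fun j hj => ?_
      rw [hJ j (Finset.mem_Ico.1 hj).2, ← Finset.mul_sum, ← Finset.mul_sum, ← Finset.mul_sum]
      ring
    rw [h₂, hswap, ← Finset.sum_add_distrib]
    congr 2
    refine Finset.sum_congr rfl fun j hj => ?_
    rw [Finset.mem_Ico] at hj
    rw [hc j hj.1 hj.2, ← Finset.sum_mul]
    ring
  have h₃ : ∑ j ∈ Finset.Icc (X + 1) R, c j * J j =
      ∑ j ∈ Finset.Icc (X + 1) R, c' j * I j + κ * ∑ j ∈ Finset.Icc (X + 1) R, c j := by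
    rw [Finset.mul_sum, ← Finset.sum_add_distrib]
    refine Finset.sum_congr rfl fun j hj => ?_
    rw [Finset.mem_Icc] at hj
    rw [hJ' j (by omega), hc' j (by omega)]
    ring
  rw [Icc_zero_split hX hXR, Icc_zero_split hX hXR, Icc_zero_split hX hXR, h₁, h₃, hcX,
    hJ' X le_rfl]
  ring

/-- The initial value 2j - 1 = (j - 1) + j already obeys the general recursion, so all l ≥ 1 can be
treated alike. -/
theorem F_succ {l : ℕ} (hl : 1 ≤ l) {j : ℤ} (hj : 1 ≤ j) :
    F (l + 1) j = ∑ i ∈ Finset.Icc 1 (j - 1), F l i + j * F l j := by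
  match l, hl with
  | 1, _ =>
    simp only [F, Finset.sum_const, Int.card_Icc, nsmul_eq_mul, mul_one]
    omega
  | l + 2, _ => rw [F]

theorem H_zero (i : ℕ) : B.H Q 0 i = ∏ k ∈ Finset.Icc i B.r, B.Da Q k := by
  simp [H]

theorem H_eq_zero {l i : ℕ} (h : B.r + 1 < l + i) (hi : i ≤ B.r + 1) : B.H Q l i = 0 := by
  rw [H, Finset.powersetCard_eq_empty.2, Finset.sum_empty]
  rw [Nat.card_Icc]
  omega

/-- The index i contributes either D_i or a_i, according to whether it lies in T. -/
theorem H_succ {l i : ℕ} (hi : i ≤ B.r) :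
    B.H Q (l + 1) i = B.Da Q i * B.H Q (l + 1) (i + 1) + B.a i * B.H Q l (i + 1) := by
  have hIcc : Finset.Icc i B.r = insert i (Finset.Icc (i + 1) B.r) :=
    (Finset.insert_Icc_add_one_left_eq_Icc hi).symm
  have hnot : i ∉ Finset.Icc (i + 1) B.r := by simp
  have hT : ∀ n, ∀ T ∈ (Finset.Icc (i + 1) B.r).powersetCard n, i ∉ T := fun n T hT h =>
    hnot ((Finset.mem_powersetCard.1 hT).1 h)
  rw [H, hIcc, Finset.powersetCard_succ_insert hnot, Finset.sum_union, Finset.sum_image]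
  · congr 1
    · rw [H, Finset.mul_sum]
      refine Finset.sum_congr rfl fun T h => ?_
      rw [Finset.insert_sdiff_of_notMem _ (hT _ T h), Finset.prod_insert (by simp)]
      ring
    · rw [H, Finset.mul_sum]
      refine Finset.sum_congr rfl fun T h => ?_
      rw [Finset.prod_insert (hT _ T h), Finset.insert_sdiff_insert,
        Finset.sdiff_insert_of_notMem hnot]
      ring
  · intro T h T' h' heq
    rw [← Finset.erase_insert (hT _ T h), ← Finset.erase_insert (hT _ T' h'), heq]
  · rw [Finset.disjoint_left]
    intro T h h'
    obtain ⟨T', -, rfl⟩ := Finset.mem_image.1 h'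
    exact hT _ _ h (Finset.mem_insert_self _ _)

theorem XOrdered.mono (h : B.XOrdered Q) {i i' : ℕ} (hi : 1 ≤ i) (hii : i ≤ i')
    (hi' : i' ≤ B.r) : B.Xlast Q i ≤ B.Xlast Q i' := by
  induction i', hii using Nat.le_induction with
  | base => exact le_rfl
  | succ i' hii ih => exact (ih (by omega)).trans (h.2 i' (by omega) (by omega))

theorem XOrdered.one_le (h : B.XOrdered Q) {i : ℕ} (hi : 1 ≤ i) (hi' : i ≤ B.r) :
    1 ≤ B.Xlast Q i :=
  h.1.trans (h.mono le_rfl hi hi')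

theorem C_zero {i : ℕ} (hi : i ≤ B.r) : B.C Q i 0 = ∏ k ∈ Finset.Icc i B.r, B.Da Q k := by
  rw [C, if_neg (by omega), if_pos rfl, if_pos rfl]
  split_ifs with h
  · simp [h]
  · rfl

/-- The separately defined case i = r fits too, because H_1 is then a_r and F^(1) is 1. -/
theorem C_eq_sum {i : ℕ} (hi : i ≤ B.r) {j : ℤ} (hj : 1 ≤ j) (hjX : j < B.Xlast Q i) :
    B.C Q i j = ∑ l ∈ Finset.Icc 1 (B.r - i + 1), F l j * B.H Q l i := by
  rw [C, if_neg (by omega)]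
  split_ifs with h h₀ h₁ h₂
  · omega
  · subst h
    have hH : B.H Q 1 B.r = B.a B.r := by
      rw [H_succ le_rfl, H_eq_zero (by omega) (by omega), H_zero]
      simp
    simp [hH, F]
  · subst h
    omega
  · subst h
    omega
  · omega
  · rfl

/-- The transposed recursion. Splitting H by `H_succ` gives a D-part, which is D times the old
coefficient, and an a-part with F of one higher order; `F_succ` turns the latter into j times the
old coefficient plus the sum of the earlier ones. -/
theorem C_step (h : B.XOrdered Q) {i : ℕ} (hi : 1 ≤ i) (hir : i < B.r) {j : ℤ} (hj : 0 ≤ j)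
    (hjX : j < B.Xlast Q i) :
    B.C Q i j = (B.Da Q i + j * B.a i) * B.C Q (i + 1) j
      + B.a i * ∑ l ∈ Finset.Ico 0 j, B.C Q (i + 1) l := by
  have hX := h.2 i hi hir
  rcases hj.eq_or_lt with rfl | hj
  · rw [C_zero hir.le, C_zero (by omega), ← Finset.insert_Icc_add_one_left_eq_Icc hir.le,
      Finset.prod_insert (by simp)]
    simp
  · rw [C_eq_sum hir.le (by omega) hjX, C_eq_sum (i := i + 1) (by omega) (by omega) (by omega),
      sum_Ico_zero_eq hj, C_zero (by omega), ← H_zero]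
    have hsum : ∑ x ∈ Finset.Icc 1 (j - 1), B.C Q (i + 1) x =
        ∑ l ∈ Finset.Icc 1 (B.r - i), (∑ x ∈ Finset.Icc 1 (j - 1), F l x) * B.H Q l (i + 1) := by
      simp_rw [Finset.sum_mul]
      rw [Finset.sum_comm]
      refine Finset.sum_congr rfl fun x hx => ?_
      rw [Finset.mem_Icc] at hx
      rw [C_eq_sum (by omega) (by omega) (by omega), show B.r - (i + 1) + 1 = B.r - i by omega]
    rw [hsum, show B.r - (i + 1) + 1 = B.r - i by omega]
    have hsplit : ∑ l ∈ Finset.Icc 1 (B.r - i + 1), F l j * B.H Q l i =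
        ∑ l ∈ Finset.range (B.r - i + 1), F (l + 1) j * B.H Q (l + 1) i := by
      rw [Finset.range_eq_Ico, Finset.sum_Ico_add' (fun l => F l j * B.H Q l i)]
      rfl
    have hIcc : ∀ f : ℕ → ℤ, ∑ l ∈ Finset.Icc 1 (B.r - i), f l =
        ∑ l ∈ Finset.range (B.r - i), f (l + 1) := by
      intro f
      rw [Finset.range_eq_Ico, Finset.sum_Ico_add' f]
      rfl
    have h₁ : ∑ l ∈ Finset.range (B.r - i + 1), F (l + 1) j * B.H Q (l + 1) i =
        B.Da Q i * ∑ l ∈ Finset.range (B.r - i + 1), F (l + 1) j * B.H Q (l + 1) (i + 1)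
        + B.a i * ∑ l ∈ Finset.range (B.r - i + 1), F (l + 1) j * B.H Q l (i + 1) := by
      rw [Finset.mul_sum, Finset.mul_sum, ← Finset.sum_add_distrib]
      refine Finset.sum_congr rfl fun l _ => ?_
      rw [H_succ hir.le]
      ring
    have h₂ : ∑ l ∈ Finset.range (B.r - i), F (l + 1 + 1) j * B.H Q (l + 1) (i + 1) =
        ∑ l ∈ Finset.range (B.r - i),
            (∑ x ∈ Finset.Icc 1 (j - 1), F (l + 1) x) * B.H Q (l + 1) (i + 1)
          + j * ∑ l ∈ Finset.range (B.r - i), F (l + 1) j * B.H Q (l + 1) (i + 1) := by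
      rw [Finset.mul_sum, ← Finset.sum_add_distrib]
      refine Finset.sum_congr rfl fun l _ => ?_
      rw [F_succ (by omega) (by omega)]
      ring
    -- The top term of the D-part vanishes, as more factors a are asked for than there are indices.
    -- The bottom term of the a-part is the product of the D's, the coefficient at 0.
    rw [hsplit, h₁, hIcc, hIcc, Finset.sum_range_succ, H_eq_zero (by omega) (by omega),
      Finset.sum_range_succ', h₂, zero_add, F]
    ring

theorem C_Xlast (h : B.XOrdered Q) {i : ℕ} (hi : 1 ≤ i) (hir : i ≤ B.r) :
    B.C Q i (B.Xlast Q i) =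
      B.a' Q i * (∑ l ∈ Finset.Ico 0 (B.Xlast Q i), B.C Q (i + 1) l)
        + (Q - B.NMax i) * B.C Q (i + 1) (B.Xlast Q i) := by
  have hX := h.one_le hi hir
  rcases hir.eq_or_lt with rfl | hir
  · have hC : ∀ j, B.C Q (B.r + 1) j = if j = 0 then 1 else 0 := fun j => by
      rw [C, if_pos (by omega)]
    rw [C, if_neg (by omega), if_pos rfl, if_neg (by omega), if_neg (by omega), if_pos rfl]
    simp only [hC, Finset.sum_ite_eq']
    rw [if_pos (by simp; omega), if_neg (by omega)]
    ring
  · rw [C, if_neg (by omega), if_neg (by omega), if_neg (by omega), if_neg (by omega), if_pos rfl]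

theorem C_of_Xlast_lt (h : B.XOrdered Q) {i : ℕ} (hi : 1 ≤ i) (hir : i < B.r) {j : ℤ}
    (hj : B.Xlast Q i < j) : B.C Q i j = (Q - B.NMax i) * B.C Q (i + 1) j := by
  have hX := h.one_le hi hir.le
  rw [C, if_neg (by omega), if_neg (by omega), if_neg (by omega), if_neg (by omega),
    if_neg (by omega)]

variable (B Q) in
/-- The number `K_i`. -/
def Kconst (i : ℕ) : ℤ :=
  (B.NMax i - B.NMin i) * B.GN Q i + B.NMin i * (Q : ℤ) ^ (B.s + B.t + i - 1)

theorem sum_C_integral_step (h : B.XOrdered Q) {i : ℕ} (hi : 1 ≤ i) (hir : i < B.r) :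
    ∑ j ∈ Finset.Icc 0 (B.Xlast Q B.r), B.C Q (i + 1) j * B.integral Q (i + 1) j =
      ∑ j ∈ Finset.Icc 0 (B.Xlast Q B.r), B.C Q i j * B.integral Q i j
        + B.Kconst Q i * ∑ j ∈ Finset.Icc 0 (B.Xlast Q B.r), B.C Q (i + 1) j := by
  have hX := h.one_le hi hir.le
  refine sum_mul_step (X := B.Xlast Q i) (by omega) (h.mono hi hir.le le_rfl) (B.Da Q i) (B.a i)
    (B.a' Q i) (Q - B.NMax i) _ _ _ _ _ ?_ ?_ (fun j hj hjX => C_step h hi hir hj hjX)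
    (C_Xlast h hi hir.le) (fun j hj => C_of_Xlast_lt h hi hir hj)
  · intro j hj
    obtain ⟨i, rfl⟩ : ∃ i', i = i' + 1 := ⟨i - 1, by omega⟩
    rw [integral, if_pos hj, Kconst,
      show B.s + B.t + (i + 1) - 1 = B.s + B.t + i by omega]
    ring
  · intro j hj
    obtain ⟨i, rfl⟩ : ∃ i', i = i' + 1 := ⟨i - 1, by omega⟩
    rw [integral, if_neg (by omega), Kconst,
      show B.s + B.t + (i + 1) - 1 = B.s + B.t + i by omega]
    ring

theorem sum_C_integral (h : B.XOrdered Q) {i : ℕ} (hi : 1 ≤ i) (hir : i ≤ B.r) :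
    ∑ j ∈ Finset.Icc 0 (B.Xlast Q B.r), B.C Q i j * B.integral Q i j =
      ∑ j ∈ Finset.Icc 0 (B.Xlast Q B.r), B.C Q 1 j * B.integral Q 1 j
        + ∑ l ∈ Finset.Ico 1 i,
            B.Kconst Q l * ∑ j ∈ Finset.Icc 0 (B.Xlast Q B.r), B.C Q (l + 1) j := by
  induction i, hi using Nat.le_induction with
  | base => simp
  | succ i hi ih =>
    rw [sum_C_integral_step h hi (by omega), ih (by omega), Finset.sum_Ico_succ_top hi]
    ring

theorem hkFormula_eq_sum (h : B.XOrdered Q) (hr : 1 ≤ B.r) :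
    B.hkFormula Q =
      ∑ j ∈ Finset.Icc 0 (B.Xlast Q B.r), B.C Q B.r j * B.integral Q B.r j
        + B.Kconst Q B.r := by
  have hX := h.one_le hr le_rfl
  have hC : ∀ j, B.C Q B.r j = if j = 0 then B.Da Q B.r
      else if j < B.Xlast Q B.r then B.a B.r
      else if j = B.Xlast Q B.r then B.a' Q B.r
      else 0 := fun j => by rw [C, if_neg (by omega), if_pos rfl]
  have h₁ : ∑ j ∈ Finset.Icc 1 (B.Xlast Q B.r - 1), B.C Q B.r j * B.integral Q B.r j =
      ∑ j ∈ Finset.Ioo 0 (B.Xlast Q B.r), B.a B.r * B.integral Q B.r j := by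
    refine Finset.sum_congr ?_ fun j hj => ?_
    · ext x
      simp only [Finset.mem_Icc, Finset.mem_Ioo]
      omega
    · rw [Finset.mem_Ioo] at hj
      rw [hC, if_neg (by omega), if_pos (by omega)]
  rw [Icc_zero_split (by omega) le_rfl, sum_Ico_zero_eq (by omega), h₁, hC 0, if_pos rfl,
    hC (B.Xlast Q B.r), if_neg (by omega), if_neg (by omega), if_pos rfl,
    Finset.Icc_eq_empty (by omega), Finset.sum_empty, hkFormula, Kconst]
  ring

theorem sum_C_eq (h : B.XOrdered Q) {i : ℕ} (hi : 1 ≤ i) (hir : i ≤ B.r) :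
    ∑ j ∈ Finset.Icc 0 (B.Xlast Q B.r), B.C Q i j =
      B.C Q i 0
        + (∑ l ∈ Finset.Icc 1 (B.r - i + 1), B.H Q l i *
            ∑ j ∈ Finset.Icc 1 (B.Xlast Q i - 1), F l j)
        + ∑ j ∈ Finset.Icc (B.Xlast Q i) (B.Xlast Q B.r), B.C Q i j := by
  have hX := h.one_le hi hir
  have hXr := h.mono hi hir le_rfl
  have h₁ : ∑ l ∈ Finset.Icc 1 (B.r - i + 1), B.H Q l i *
      ∑ j ∈ Finset.Icc 1 (B.Xlast Q i - 1), F l j =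
        ∑ j ∈ Finset.Icc 1 (B.Xlast Q i - 1), B.C Q i j := by
    simp_rw [Finset.mul_sum]
    rw [Finset.sum_comm]
    refine Finset.sum_congr rfl fun j hj => ?_
    rw [Finset.mem_Icc] at hj
    rw [C_eq_sum hir (by omega) (by omega)]
    exact Finset.sum_congr rfl fun l _ => mul_comm _ _
  have h₂ : Finset.Icc (B.Xlast Q i) (B.Xlast Q B.r) =
      insert (B.Xlast Q i) (Finset.Icc (B.Xlast Q i + 1) (B.Xlast Q B.r)) :=
    (Finset.insert_Icc_add_one_left_eq_Icc hXr).symm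
  rw [h₁, h₂, Finset.sum_insert (by simp), Icc_zero_split (by omega) hXr,
    sum_Ico_zero_eq (by omega)]
  ring

theorem hkFormula_eq_hkExpanded (h : B.XOrdered Q) (hr : 1 ≤ B.r) :
    B.hkFormula Q = B.hkExpanded Q := by
  have hX := h.one_le le_rfl hr
  have hXr := h.mono le_rfl hr le_rfl
  have h₁ : ∑ j ∈ Finset.Icc (B.Xlast Q 1 + 1) (B.Xlast Q B.r), B.C Q 1 j * B.integral Q 1 j =
      (Q - B.NMax 1) *
        ∑ j ∈ Finset.Icc (B.Xlast Q 1 + 1) (B.Xlast Q B.r), B.C Q 2 j * B.integral Q 1 j := by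
    rcases hr.eq_or_lt with hr | hr
    · rw [← hr, Finset.Icc_eq_empty (by omega)]
      simp
    · rw [Finset.mul_sum]
      refine Finset.sum_congr rfl fun j hj => ?_
      rw [Finset.mem_Icc] at hj
      rw [C_of_Xlast_lt h le_rfl hr (by omega)]
      ring
  have h₂ : ∑ l ∈ Finset.Ico 1 B.r,
      B.Kconst Q l * ∑ j ∈ Finset.Icc 0 (B.Xlast Q B.r), B.C Q (l + 1) j =
      ∑ c ∈ Finset.Icc 1 (B.r - 1),
        ((B.NMax (B.r - c) - B.NMin (B.r - c)) * B.GN Q (B.r - c)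
            + B.NMin (B.r - c) * (Q : ℤ) ^ (B.s + B.t + B.r - c - 1)) *
          (B.C Q (B.r - c + 1) 0
            + (∑ l ∈ Finset.Icc 1 c, B.H Q l (B.r - c + 1) *
                ∑ j ∈ Finset.Icc 1 (B.Xlast Q (B.r - c + 1) - 1), F l j)
            + ∑ j ∈ Finset.Icc (B.Xlast Q (B.r - c + 1)) (B.Xlast Q B.r),
                B.C Q (B.r - c + 1) j) := by
    -- The stated sum runs over c = r - l.
    refine Finset.sum_nbij' (fun l => B.r - l) (fun c => B.r - c) ?_ ?_ ?_ ?_ ?_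
    · intro l hl
      simp only [Finset.mem_Ico, Finset.mem_Icc] at hl ⊢
      omega
    · intro l hl
      simp only [Finset.mem_Ico, Finset.mem_Icc] at hl ⊢
      omega
    · intro l hl
      simp only [Finset.mem_Ico] at hl ⊢
      omega
    · intro l hl
      simp only [Finset.mem_Icc] at hl ⊢
      omega
    · intro l hl
      rw [Finset.mem_Ico] at hl
      have e₁ : B.r - (B.r - l) = l := by omega
      have e₂ : B.r - (l + 1) + 1 = B.r - l := by omega
      have e₃ : B.s + B.t + B.r - (B.r - l) - 1 = B.s + B.t + l - 1 := by omega
      rw [e₁, sum_C_eq h (by omega) (by omega), e₂, e₃, Kconst]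
  rw [hkFormula_eq_sum h hr, sum_C_integral h hr le_rfl, h₂, Icc_zero_split (by omega) hXr, h₁,
    C_Xlast h le_rfl hr, hkExpanded, Kconst]
  ring

end Expanded

end Exponents

end BinomialHK

namespace BinomialHK

namespace Exponents

variable {m : ℕ} {B : Exponents m} {Q : ℕ}

/-! ### The closed form of `Φ` in the simple case -/

section Closed

theorem prod_const_sub (S : Finset ℕ) (x : ℤ) (f : ℕ → ℤ) :
    ∏ q ∈ S, (x - f q) = ∑ l ∈ Finset.range (S.card + 1),
      (-1) ^ l * x ^ (S.card - l) * ∑ T ∈ S.powersetCard l, ∏ q ∈ T, f q := by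
  have h : ∀ q, x - f q = -f q + x := fun q => by ring
  simp_rw [h, Finset.prod_add, Finset.sum_powerset, Finset.mul_sum]
  refine Finset.sum_congr rfl fun l _ => Finset.sum_congr rfl fun T hT => ?_
  obtain ⟨hTS, hcard⟩ := Finset.mem_powersetCard.1 hT
  rw [Finset.prod_neg, Finset.prod_const, Finset.card_sdiff_of_subset hTS, hcard]
  ring

/-- Expanding ∏(μ + P_min) over all subsets U of T and discarding U = ∅ and U = T leaves the mixed
products. For l = 0 these two subsets coincide and are subtracted twice, hence the correction. -/
theorem mixedSum_eq (M : ℤ) (l : ℕ) :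
    B.mixedSum Q M l =
      ∑ T ∈ (Finset.Icc 1 B.t).powersetCard l, ∏ q ∈ T, (B.minc Q M q + B.PMin q)
      - ∑ T ∈ (Finset.Icc 1 B.t).powersetCard l, ∏ q ∈ T, B.minc Q M q
      - ∑ T ∈ (Finset.Icc 1 B.t).powersetCard l, ∏ q ∈ T, B.PMin q
      + if l = 0 then 1 else 0 := by
  rcases Nat.eq_zero_or_pos l with rfl | hl
  · simp [mixedSum, Finset.filter_singleton]
  rw [if_neg (by omega), add_zero, ← Finset.sum_sub_distrib, ← Finset.sum_sub_distrib, mixedSum]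
  refine Finset.sum_congr rfl fun T hT => ?_
  have hT₀ : T ≠ ∅ := by
    rintro rfl
    have := (Finset.mem_powersetCard.1 hT).2
    simp at this
    omega
  have hfilter : T.powerset.filter (fun U => U ≠ ∅ ∧ U ≠ T) = (T.powerset.erase ∅).erase T := by
    ext U
    simp only [Finset.mem_filter, Finset.mem_erase]
    tauto
  rw [hfilter, Finset.prod_add, ← Finset.add_sum_erase T.powerset _ (Finset.empty_mem_powerset T),
    ← Finset.add_sum_erase (T.powerset.erase ∅) _
      (Finset.mem_erase.2 ⟨hT₀, Finset.mem_powerset_self T⟩)]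
  simp only [Finset.prod_empty, Finset.sdiff_empty, Finset.sdiff_self, one_mul, mul_one]
  ring

theorem mixedSum_of_lt_two (M : ℤ) {l : ℕ} (hl : l < 2) : B.mixedSum Q M l = 0 := by
  rw [mixedSum_eq]
  interval_cases l
  · simp
  · simp [Finset.powersetCard_one, Finset.sum_add_distrib]

theorem prod_sub_sub (M : ℤ) :
    ∏ q ∈ Finset.Icc 1 B.t, ((Q : ℤ) - B.PMin q - B.minc Q M q) =
      ∑ l ∈ Finset.Icc 2 B.t, (-1) ^ l * B.mixedSum Q M l * (Q : ℤ) ^ (B.t - l)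
        + ∏ q ∈ Finset.Icc 1 B.t, ((Q : ℤ) - B.minc Q M q)
        + ∏ q ∈ Finset.Icc 1 B.t, ((Q : ℤ) - B.PMin q) - (Q : ℤ) ^ B.t := by
  have h : ∀ q, (Q : ℤ) - B.PMin q - B.minc Q M q = Q - (B.minc Q M q + B.PMin q) :=
    fun q => by ring
  have hmixed : ∑ l ∈ Finset.Icc 2 B.t, (-1) ^ l * B.mixedSum Q M l * (Q : ℤ) ^ (B.t - l) =
      ∑ l ∈ Finset.range (B.t + 1), (-1) ^ l * B.mixedSum Q M l * (Q : ℤ) ^ (B.t - l) := by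
    refine Finset.sum_subset (fun l hl => ?_) fun l hl hl' => ?_
    · simp only [Finset.mem_Icc, Finset.mem_range] at hl ⊢
      omega
    · rw [mixedSum_of_lt_two]
      · ring
      · simp only [Finset.mem_Icc, Finset.mem_range] at hl hl'
        omega
  have hone : (Q : ℤ) ^ B.t = ∑ l ∈ Finset.range (B.t + 1),
      (-1) ^ l * (if l = 0 then 1 else 0) * (Q : ℤ) ^ (B.t - l) := by
    simp
  simp_rw [h]
  rw [hmixed, prod_const_sub, prod_const_sub, prod_const_sub, hone, Nat.card_Icc,
    Nat.add_sub_cancel, ← Finset.sum_add_distrib, ← Finset.sum_add_distrib,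
    ← Finset.sum_sub_distrib]
  refine Finset.sum_congr rfl fun l _ => ?_
  rw [mixedSum_eq]
  ring

theorem frakS_eq (M : ℤ) (l : ℕ) :
    B.frakS Q M l = B.frakS Q M 0 * ∏ i ∈ Finset.Icc 1 l, ((Q : ℤ) - B.ZMin i)
      + (Q : ℤ) ^ B.t * ((Q : ℤ) ^ l - ∏ i ∈ Finset.Icc 1 l, ((Q : ℤ) - B.ZMin i)) := by
  induction l with
  | zero => simp
  | succ l ih =>
    rw [frakS.eq_2, ih, Finset.prod_Icc_succ_top (by omega)]
    ring

/-- The lower bound on μ makes h vanish, which kills the last product in `Dtilde_eq`; the upper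
bound means that the minimum defining μ is MΔ. -/
theorem Φ_eq_ΦClosed {M : ℤ} (ht : 1 ≤ B.t) (h : B.Simple Q M) : B.Φ Q M = B.ΦClosed Q M := by
  have hh : ∏ x ∈ Finset.Ico 1 (B.t + 1), B.hP Q M x = 0 := by
    refine Finset.prod_eq_zero (i := 1) (by simp; omega) ?_
    have := (h 1 le_rfl ht).1
    rw [hP, if_neg (by omega)]
  have hμ : ∏ q ∈ Finset.Icc 1 B.t, ((Q : ℤ) - B.minc Q M q) =
      ∏ q ∈ Finset.Icc 1 B.t, ((Q : ℤ) - M * B.ΔP q) := by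
    refine Finset.prod_congr rfl fun q hq => ?_
    rw [Finset.mem_Icc] at hq
    have := (h q hq.1 hq.2).2
    rw [minc] at this ⊢
    congr 1
    omega
  have hIco : Finset.Ico 1 (B.t + 1) = Finset.Icc 1 B.t := rfl
  have hZ : ∑ c ∈ Finset.Icc 1 B.s, (-1) ^ (c + 1) * (Q : ℤ) ^ (B.t + B.s - c) *
      ∑ T ∈ (Finset.Icc 1 B.s).powersetCard c, ∏ i ∈ T, B.ZMin i =
      (Q : ℤ) ^ B.t * ((Q : ℤ) ^ B.s - ∏ i ∈ Finset.Icc 1 B.s, ((Q : ℤ) - B.ZMin i)) := by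
    rw [prod_const_sub, Nat.card_Icc, Nat.add_sub_cancel, Finset.range_eq_Ico,
      Finset.sum_eq_sum_Ico_succ_bot (by omega)]
    simp only [pow_zero, one_mul, tsub_zero, Finset.powersetCard_zero, Finset.sum_singleton,
      Finset.prod_empty, mul_one, sub_add_cancel_left, zero_add]
    rw [← Finset.sum_neg_distrib, Finset.mul_sum]
    refine Finset.sum_congr rfl fun c hc => ?_
    rw [Finset.mem_Ico] at hc
    rw [Nat.add_sub_assoc (by omega : c ≤ B.s), pow_add, pow_succ]
    ring
  rw [Φ, frakS_eq, frakS_zero, Dtilde_eq B Q M (by omega), hh, ΦClosed, hZ, hIco, prod_sub_sub, hμ,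
    Cq, Nat.add_sub_cancel]
  ring

end Closed

/-! ### The range of validity -/

section Range

theorem a_le_a_r (hΔ : Monotone B.Δ) {i : ℕ} (hi : 1 ≤ i) (hir : i ≤ B.r) : B.a i ≤ B.a B.r := by
  have hm : B.r ≤ m := by
    have := B.r_add_s_le
    omega
  rw [a, a, diff, diff, dif_pos (by omega), dif_pos (by omega), neg_le_neg_iff]
  exact hΔ (by simp)

/-- Suppose K_i < K_r. If a_i = a_r, this contradicts b_i ≤ b_r. Otherwise (a_i + 1)(K_i + 1) ≤ Q -
1 < a_i(K_i + 1) + b_i, so K_i + 1 ≤ b_i, and then Q < 1 + b_i + a_i b_i. -/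
theorem quotient_le_quotient (hΔ : Monotone B.Δ) {i : ℕ} (hi : 1 ≤ i) (hir : i ≤ B.r)
    (hb : B.a i = B.a B.r → B.b i ≤ B.b B.r) (hQ : 1 + B.b i + B.a i * B.b i ≤ Q) :
    B.Mq Q B.r - B.pa Q B.r ≤ B.Mq Q i - B.pa Q i := by
  have ha := a_pos hΔ hi hir
  have har := a_pos hΔ (hi.trans hir) le_rfl
  obtain ⟨h₁, h₂, h₃⟩ := B.div_spec (Q := Q) ha
  obtain ⟨h₄, h₅, h₆⟩ := B.div_spec (Q := Q) har
  have hle := a_le_a_r hΔ hi hir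
  have hb₀ := B.b_nonneg (i := i)
  have hbr := B.b_nonneg (i := B.r)
  set K := B.Mq Q i - B.pa Q i
  set K' := B.Mq Q B.r - B.pa Q B.r
  by_contra hlt
  have hKK : K + 1 ≤ K' := by omega
  have h₇ : B.a B.r * (K + 1) ≤ B.a B.r * K' := mul_le_mul_of_nonneg_left hKK har.le
  rcases hle.eq_or_lt with heq | hlt'
  · have := hb heq
    rw [heq] at h₁ h₃
    linarith
  · have hK : 0 < K + 1 := by
      by_contra hK
      have : B.a i * (K + 1) ≤ 0 := mul_nonpos_of_nonneg_of_nonpos ha.le (by omega)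
      have : 0 ≤ B.a i * B.b i := mul_nonneg ha.le hb₀
      linarith
    have h₈ : (B.a i + 1) * (K + 1) ≤ B.a B.r * (K + 1) :=
      mul_le_mul_of_nonneg_right (by omega) hK.le
    have h₉ : K + 1 ≤ B.b i := by linarith
    have : B.a i * (K + 1) ≤ B.a i * B.b i := mul_le_mul_of_nonneg_left h₉ ha.le
    linarith

/-- All X̃_i are then equal to K_r - 1. -/
theorem xOrdered_of_two_le (hΔ : Monotone B.Δ) (hr : 1 ≤ B.r)
    (hK : ∀ i, 1 ≤ i → i ≤ B.r → B.Mq Q B.r - B.pa Q B.r ≤ B.Mq Q i - B.pa Q i)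
    (h₂ : 2 ≤ B.Mq Q B.r - B.pa Q B.r) : B.XOrdered Q := by
  have hX : ∀ i, 1 ≤ i → i ≤ B.r → B.Xlast Q i = B.Mq Q B.r - B.pa Q B.r - 1 := by
    intro i hi hir
    have := hK i hi hir
    rw [Xlast, kLast_eq hΔ hi hir]
    omega
  refine ⟨?_, fun i hi hir => ?_⟩
  · rw [hX 1 le_rfl hr]
    omega
  · rw [hX i hi hir.le, hX (i + 1) (by omega) hir]

theorem eventually_admissible (hΔ : Monotone B.Δ) {p : ℕ} (hp : 1 < p) (hr : 1 ≤ B.r)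
    (hb : ∀ i : ℕ, 1 ≤ i → i ≤ B.r → B.a i = B.a B.r → B.b i ≤ B.b B.r) :
    ∀ᶠ n : ℕ in Filter.atTop, B.Admissible (p ^ n) ∧ B.XOrdered (p ^ n) := by
  have hlarge : ∀ x : ℤ, ∀ᶠ n : ℕ in Filter.atTop, x ≤ ((p ^ n : ℕ) : ℤ) := fun x =>
    (tendsto_natCast_atTop_atTop.comp (tendsto_pow_atTop_atTop_of_one_lt hp)).eventually_ge_atTop x
  have h₁ : ∀ᶠ n : ℕ in Filter.atTop, ∀ i, (B.e₂ i : ℤ) + 1 ≤ ((p ^ n : ℕ) : ℤ) :=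
    Filter.eventually_all.2 fun i => hlarge _
  have h₂ : ∀ᶠ n : ℕ in Filter.atTop, ∀ i, (B.e₁ i : ℤ) ≤ ((p ^ n : ℕ) : ℤ) :=
    Filter.eventually_all.2 fun i => hlarge _
  have h₃ : ∀ᶠ n : ℕ in Filter.atTop, ∀ i ∈ Finset.Icc 1 B.r,
      1 + B.b i + B.a i * B.b i ≤ ((p ^ n : ℕ) : ℤ) :=
    (Filter.eventually_all_finset _).2 fun i _ => hlarge _
  -- The last bound gives Q - 1 - b_r ≥ 2a_r and hence K_r ≥ 2.
  filter_upwards [h₁, h₂, h₃, hlarge (1 + B.b B.r + 2 * B.a B.r)] with n h₁ h₂ h₃ h₄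
  have hK : ∀ i, 1 ≤ i → i ≤ B.r →
      B.Mq (p ^ n) B.r - B.pa (p ^ n) B.r ≤ B.Mq (p ^ n) i - B.pa (p ^ n) i := fun i hi hir =>
    quotient_le_quotient hΔ hi hir (hb i hi hir) (h₃ i (Finset.mem_Icc.2 ⟨hi, hir⟩))
  refine ⟨⟨fun i => ?_, fun i => ?_, hK⟩, xOrdered_of_two_le hΔ hr hK ?_⟩
  · have := h₁ i
    omega
  · exact_mod_cast h₂ i
  · have ha := a_pos hΔ hr le_rfl
    obtain ⟨h₅, h₆, h₇⟩ := B.div_spec (Q := p ^ n) ha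
    by_contra hlt
    have : B.a B.r * (B.Mq (p ^ n) B.r - B.pa (p ^ n) B.r) ≤ B.a B.r * 1 :=
      mul_le_mul_of_nonneg_left (by omega) ha.le
    linarith

end Range

end Exponents

end BinomialHK

theorem mainTheorem2 {k : Type*} [Field k] (p : ℕ) [Fact p.Prime] [CharP k p]
    {m : ℕ} (B : BinomialHK.Exponents m) (c₂ c₁ : k) (hc₂ : c₂ ≠ 0) (hc₁ : c₁ ≠ 0)
    (hΔ : Monotone B.Δ) (hr : 1 ≤ B.r) :
    (∀ n : ℕ, B.Admissible (p ^ n) →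
      ∃ L : ℕ, BinomialHK.hkLength (B.poly c₂ c₁) (p ^ n) = (L : ℕ∞) ∧
        (L : ℤ) = B.hkFormula (p ^ n) ∧
        (B.XOrdered (p ^ n) → (L : ℤ) = B.hkExpanded (p ^ n))) ∧
    (∀ n : ℕ, ∀ M : ℤ, 1 ≤ B.t → B.Simple (p ^ n) M →
      B.Φ (p ^ n) M = B.ΦClosed (p ^ n) M) ∧
    ((∀ i : ℕ, 1 ≤ i → i ≤ B.r → B.a i = B.a B.r → B.b i ≤ B.b B.r) →
      ∀ᶠ n : ℕ in Filter.atTop, B.Admissible (p ^ n) ∧ B.XOrdered (p ^ n)) := by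
  have hp : p.Prime := Fact.out
  refine ⟨fun n h => ?_, fun n M ht h => BinomialHK.Exponents.Φ_eq_ΦClosed ht h,
    BinomialHK.Exponents.eventually_admissible hΔ hp.one_lt hr⟩
  obtain ⟨L, hL, hL'⟩ := BinomialHK.Exponents.hkLength_eq hΔ hc₂ hc₁ hr h (pow_pos hp.pos n)
  exact ⟨L, hL, hL', fun hX => hL'.trans (BinomialHK.Exponents.hkFormula_eq_hkExpanded hX hr)⟩
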